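/- Let $V$ be a real, finite signed Borel measure on $\mathbb{R}$ and let $h>0$. Every $u\in H^1(\mathbb{R})$ has a unique continuous, bounded representative, denoted $u_c$, and we define the distribution $$Pu := -h^2u'' + u_cV ,$$ where $u_cV$ is the complex Borel measure with density $u_c$ with respect to $V$. Put $$\mathcal{D} := \{u\in H^1(\mathbb{R}) : u'\in L^\infty(\mathbb{R}) \text{ and } Pu\in L^2(\mathbb{R})\}.$$ Here $L^2(\mathbb{R})$ consists of complex-valued functions, with inner product $\langle f,g\rangle=\int \overline{f}g\,dx$. Then: 1. $\mathcal{D}$ is dense in $L^2(\mathbb{R})$. 2. The operator $P:L^2(\mathbb{R})\to L^2(\mathbb{R})$, $u\mapsto Pu$, with domain $\mathcal{D}$ is self-adjoint, that is, $P^*=P$ (including equality of domains). 3. The sesquilinear form $$q(u,v) := \int h^2\,\overline{u'}\,v'\,dx + \int \overline{u_c}\,v_c\,dV ,\qquad u,v\in H^1(\mathbb{R}),$$ is Hermitian, semibounded (there is $\gamma\in\mathbb{R}$ with $q(u,u)\ge\gamma\|u\|_{L^2}^2$ for all $u\in H^1(\mathbb{R})$) and closed (if $u_n\in H^1(\mathbb{R})$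 converges to $u$ in $L^2(\mathbb{R})$ and $q(u_n-u_m,u_n-u_m)\to0$ as $n,m\to\infty$, then $u\in H^1(\mathbb{R})$ and $q(u_n-u,u_n-u)\to0$), and $P$ is the operator associated with $q$: for $u,f\in L^2(\mathbb{R})$ one has $u\in\mathcal{D}$ and $Pu=f$ if and only if $u\in H^1(\mathbb{R})$ and $q(u,v)=\langle f,v\rangle$ for all $v\in H^1(\mathbb{R})$. -/

import Mathlib

namespace MeasureSchrodinger

noncomputable section

open MeasureTheory Filter Topology Set
open scoped ContDiff ENNReal ComplexConjugate

/-- The Hilbert space `L²(ℝ)` of complex-valued functions, with respect to Lebesgue measure.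
Its inner product `inner ℂ f g = ∫ conj f * g` is conjugate linear in the first variable. -/
abbrev L2 : Type := Lp ℂ 2 (volume : Measure ℝ)

/-- `φ ∈ C₀^∞(ℝ)`, complex valued. -/
structure IsTestFunction (φ : ℝ → ℂ) : Prop where
  contDiff : ContDiff ℝ ∞ φ
  hasCompactSupport : HasCompactSupport φ

/-- `w` is the distributional derivative of `u` (for locally integrable `u` and `w`). -/
def IsWeakDeriv (u w : ℝ → ℂ) : Prop :=
  ∀ φ : ℝ → ℂ, IsTestFunction φ → ∫ x, u x * deriv φ x = -∫ x, w x * φ x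

theorem IsTestFunction.deriv {φ : ℝ → ℂ} (hφ : IsTestFunction φ) : IsTestFunction (deriv φ) :=
  ⟨(contDiff_infty_iff_deriv.1 hφ.1).2, hφ.2.deriv⟩

theorem IsTestFunction.continuous {φ : ℝ → ℂ} (hφ : IsTestFunction φ) : Continuous φ :=
  hφ.1.continuous

theorem L2.locallyIntegrable (u : L2) : LocallyIntegrable (u : ℝ → ℂ) volume :=
  (Lp.memLp u).locallyIntegrable (by norm_num)

theorem L2.integrable_mul (u : L2) {φ : ℝ → ℂ} (hφ : IsTestFunction φ) :
    Integrable (fun x => (u : ℝ → ℂ) x * φ x) :=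
  (L2.locallyIntegrable u).integrable_smul_right_of_hasCompactSupport hφ.continuous hφ.2

theorem ae_eq_of_forall_test {f g : ℝ → ℂ} (hf : LocallyIntegrable f volume)
    (hg : LocallyIntegrable g volume)
    (h : ∀ φ : ℝ → ℂ, IsTestFunction φ → ∫ x, f x * φ x = ∫ x, g x * φ x) : f =ᵐ[volume] g := by
  refine ae_eq_of_integral_contDiff_smul_eq hf hg fun k hk hk' => ?_
  have := h (fun x => (k x : ℂ)) ⟨Complex.ofRealCLM.contDiff.comp hk,
    hk'.comp_left (g := fun t : ℝ => (t : ℂ)) (by simp)⟩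
  simpa [mul_comm] using this

theorem L2.ext_of_forall_test {f g : L2}
    (h : ∀ φ : ℝ → ℂ, IsTestFunction φ → ∫ x, f x * φ x = ∫ x, g x * φ x) : f = g :=
  Lp.ext (ae_eq_of_forall_test f.locallyIntegrable g.locallyIntegrable h)

theorem L2.integral_add_mul (f g : L2) {φ : ℝ → ℂ} (hφ : IsTestFunction φ) :
    ∫ x, (f + g : L2) x * φ x = (∫ x, f x * φ x) + ∫ x, g x * φ x := by
  rw [← integral_add (f.integrable_mul hφ) (g.integrable_mul hφ)]
  refine integral_congr_ae ?_
  filter_upwards [Lp.coeFn_add f g] with x hx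
  rw [hx, Pi.add_apply, add_mul]

theorem L2.integral_smul_mul (c : ℂ) (f : L2) (φ : ℝ → ℂ) :
    ∫ x, (c • f : L2) x * φ x = c * ∫ x, f x * φ x := by
  rw [← integral_const_mul]
  refine integral_congr_ae ?_
  filter_upwards [Lp.coeFn_smul c f] with x hx
  rw [hx, Pi.smul_apply, smul_eq_mul, mul_assoc]

theorem L2.integral_zero_mul (φ : ℝ → ℂ) : ∫ x, (0 : L2) x * φ x = 0 := by
  simp

theorem IsWeakDeriv.add {u v w z : L2} (h : IsWeakDeriv u w) (h' : IsWeakDeriv v z) :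
    IsWeakDeriv (u + v : L2) (w + z : L2) := fun φ hφ => by
  rw [L2.integral_add_mul _ _ hφ.deriv, L2.integral_add_mul _ _ hφ, h φ hφ, h' φ hφ]; ring

theorem IsWeakDeriv.smul {u w : L2} (c : ℂ) (h : IsWeakDeriv u w) :
    IsWeakDeriv (c • u : L2) (c • w : L2) := fun φ hφ => by
  rw [L2.integral_smul_mul, L2.integral_smul_mul, h φ hφ]; ring

theorem IsWeakDeriv.unique {u w z : L2} (h : IsWeakDeriv u w) (h' : IsWeakDeriv u z) : w = z :=
  L2.ext_of_forall_test fun φ hφ => neg_injective (by rw [← h φ hφ, ← h' φ hφ])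

/-- The Sobolev space `H¹(ℝ)`: the `u ∈ L²` whose distributional derivative belongs to `L²`. -/
def H1 : Submodule ℂ L2 where
  carrier := {u | ∃ w : L2, IsWeakDeriv u w}
  add_mem' := by
    rintro u v ⟨w, hw⟩ ⟨z, hz⟩
    exact ⟨w + z, hw.add hz⟩
  zero_mem' := ⟨0, fun φ _ => by simp only [L2.integral_zero_mul, neg_zero]⟩
  smul_mem' := by
    rintro c u ⟨w, hw⟩
    exact ⟨c • w, hw.smul c⟩

/-- The distributional derivative `u' ∈ L²` of `u ∈ H¹`; it is unique by `IsWeakDeriv.unique`. -/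
def weakDeriv : H1 →ₗ[ℂ] L2 where
  toFun u := u.2.choose
  map_add' u v := IsWeakDeriv.unique (u + v).2.choose_spec (u.2.choose_spec.add v.2.choose_spec)
  map_smul' c u := IsWeakDeriv.unique (c • u).2.choose_spec (u.2.choose_spec.smul c)

theorem weakDeriv_spec (u : H1) : IsWeakDeriv (u : L2) (weakDeriv u) := u.2.choose_spec

theorem ac_primitive {w : ℝ → ℂ} (hw : LocallyIntegrable w volume) (a b : ℝ) :
    AbsolutelyContinuousOnInterval (fun x => ∫ t in (0 : ℝ)..x, w t) a b := by
  have hI : ∀ x y, IntervalIntegrable w volume x y := fun x y =>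
    (hw.integrableOn_isCompact isCompact_uIcc).mono_set uIoc_subset_uIcc |> intervalIntegrable_iff.2
  have h1 := (hI a b).norm.absolutelyContinuousOnInterval_intervalIntegral (c := a) (by simp)
  refine squeeze_zero (fun t => Finset.sum_nonneg fun i _ => dist_nonneg) (fun t => ?_) h1
  refine Finset.sum_le_sum fun i _ => ?_
  rw [dist_eq_norm, dist_eq_norm, intervalIntegral.integral_interval_sub_left (hI _ _) (hI _ _),
    intervalIntegral.integral_interval_sub_left (hI _ _).norm (hI _ _).norm, Real.norm_eq_abs]
  exact intervalIntegral.norm_integral_le_abs_integral_norm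

theorem isWeakDeriv_primitive {w : ℝ → ℂ} (hw : LocallyIntegrable w volume) :
    IsWeakDeriv (fun x => ∫ t in (0 : ℝ)..x, w t) w := by
  intro φ hφ
  set U : ℝ → ℂ := fun x => ∫ t in (0 : ℝ)..x, w t with hU
  have hI : ∀ x y, IntervalIntegrable w volume x y := fun x y =>
    (hw.integrableOn_isCompact isCompact_uIcc).mono_set uIoc_subset_uIcc |> intervalIntegrable_iff.2
  have hUc : Continuous U := intervalIntegral.continuous_primitive hI 0
  have hi1 : Integrable (fun x => U x * deriv φ x) :=
    hUc.locallyIntegrable.integrable_smul_right_of_hasCompactSupport hφ.deriv.continuous hφ.deriv.2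
  have hi2 : Integrable (fun x => w x * φ x) :=
    hw.integrable_smul_right_of_hasCompactSupport hφ.continuous hφ.2
  rw [eq_neg_iff_add_eq_zero, ← integral_add hi1 hi2]
  obtain ⟨R, hR⟩ := hφ.2.isCompact.isBounded.subset_closedBall 0
  have hz : ∀ x, R < |x| → φ x = 0 := fun x hx => by
    by_contra h
    have := hR (subset_tsupport _ h)
    simp at this; linarith
  have hz' : ∀ x, R < |x| → deriv φ x = 0 := fun x hx => by
    by_contra h
    have := hR (support_deriv_subset h)
    simp at this; linarith
  set S := |R| + 1 with hS
  have hRS : R < S := by linarith [le_abs_self R]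
  have hS0 : 0 < S := by positivity
  set g : ℝ → ℂ := fun x => U x * deriv φ x + w x * φ x with hg
  have hgi : Integrable g := hi1.add hi2
  have hsupp : Function.support g ⊆ Ioc (-S) S := by
    intro x hx
    by_contra h
    have : S ≤ |x| := by
      rw [mem_Ioc, not_and_or, not_lt, not_le] at h
      rcases h with h | h
      · exact le_trans (by linarith) (neg_le_abs x)
      · exact h.le.trans (le_abs_self x)
    apply hx
    simp [hg, hz x (by linarith), hz' x (by linarith)]
  rw [← intervalIntegral.integral_eq_integral_of_support_subset hsupp]
  have hgl := hgi.locallyIntegrable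
  have hprod : AbsolutelyContinuousOnInterval (U • φ) (-S) S :=
    (ac_primitive hw _ _).smul
      (hφ.1.of_le (by exact_mod_cast le_top)).contDiffOn.absolutelyContinuousOnInterval
  obtain ⟨C, hC⟩ := (hprod.sub (ac_primitive hgl (-S) S)).const_of_ae_hasDerivAt_zero (by
    filter_upwards [LocallyIntegrable.ae_hasDerivAt_integral hw,
      LocallyIntegrable.ae_hasDerivAt_integral hgl] with x h1 h2 _
    have h3 := ((h1 0).smul ((hφ.1.differentiable (by simp)) x).hasDerivAt).sub (h2 0)
    convert h3 using 1
    simp only [hg, smul_eq_mul]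
    ring)
  have e1 := hC S (by simp)
  have e2 := hC (-S) (by simp)
  have hI' : ∀ x y, IntervalIntegrable g volume x y := fun x y => hgi.intervalIntegrable
  simp only [Pi.sub_apply, Pi.mul_apply, smul_eq_mul] at e1 e2
  rw [hz S (by rwa [abs_of_pos hS0])] at e1
  rw [hz (-S) (by rwa [abs_neg, abs_of_pos hS0])] at e2
  rw [← intervalIntegral.integral_interval_sub_left (hI' 0 S) (hI' 0 (-S))]
  linear_combination e2 - e1

/-- A locally integrable function with vanishing weak derivative is constant. -/
theorem ae_const_of_weakDeriv_zero {f : ℝ → ℂ} (hf : LocallyIntegrable f volume)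
    (h : ∀ φ : ℝ → ℂ, IsTestFunction φ → ∫ x, f x * deriv φ x = 0) :
    ∃ c : ℂ, f =ᵐ[volume] fun _ => c := by
  let b : ContDiffBump (0 : ℝ) := ⟨1, 2, by norm_num, by norm_num⟩
  set ψ : ℝ → ℂ := fun x => ((b.normed volume x : ℝ) : ℂ) with hψ
  have hψt : IsTestFunction ψ := ⟨Complex.ofRealCLM.contDiff.comp b.contDiff_normed,
    b.hasCompactSupport_normed.comp_left (g := fun t : ℝ => (t : ℂ)) (by simp)⟩
  have hψ1 : ∫ x, ψ x = 1 := by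
    rw [hψ, integral_complex_ofReal, b.integral_normed]; simp
  have hmul : ∀ {φ : ℝ → ℂ}, IsTestFunction φ → Integrable (fun x => f x * φ x) := fun hφ =>
    hf.integrable_smul_right_of_hasCompactSupport hφ.continuous hφ.2
  refine ⟨∫ x, f x * ψ x, ae_eq_of_forall_test hf (locallyIntegrable_const _) fun φ hφ => ?_⟩
  have hφi : Integrable φ := hφ.continuous.integrable_of_hasCompactSupport hφ.2
  have hψi : Integrable ψ := hψt.continuous.integrable_of_hasCompactSupport hψt.2
  set m := ∫ x, φ x with hm
  set g : ℝ → ℂ := fun x => φ x - m * ψ x with hg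
  have hgc : ContDiff ℝ ∞ g := hφ.1.sub (contDiff_const.mul hψt.1)
  have hgi : Integrable g := hφi.sub (hψi.const_mul m)
  have hg0 : ∫ x, g x = 0 := by
    rw [hg, integral_sub hφi (hψi.const_mul m), integral_const_mul, hψ1, ← hm]; ring
  have hgs : HasCompactSupport g := hφ.2.sub (hψt.2.mul_left)
  obtain ⟨R, hR⟩ := hgs.isCompact.isBounded.subset_closedBall 0
  have hz : ∀ x, R < |x| → g x = 0 := fun x hx => by
    by_contra h
    have := hR (subset_tsupport _ h)
    simp at this; linarith
  set S := |R| + 1 with hS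
  have hRS : R < S := by linarith [le_abs_self R]
  have hS0 : 0 < S := by positivity
  set G : ℝ → ℂ := fun x => ∫ t in (-S)..x, g t with hG
  have hGd : ∀ x, HasDerivAt G (g x) x := fun x =>
    intervalIntegral.integral_hasDerivAt_right hgi.intervalIntegrable
      hgc.continuous.aestronglyMeasurable.stronglyMeasurableAtFilter hgc.continuous.continuousAt
  have hGd' : deriv G = g := funext fun x => (hGd x).deriv
  have hGt : IsTestFunction G := by
    refine ⟨contDiff_infty_iff_deriv.2 ⟨fun x => (hGd x).differentiableAt, hGd' ▸ hgc⟩, ?_⟩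
    refine HasCompactSupport.intro (isCompact_Icc (a := -S) (b := S)) fun x hx => ?_
    rw [mem_Icc, not_and_or, not_le, not_le] at hx
    rcases hx with hx | hx
    · refine intervalIntegral.integral_zero_ae (Eventually.of_forall fun t ht => hz t ?_)
      rw [uIoc_of_ge hx.le, mem_Ioc] at ht
      rcases eq_or_ne t (-S) with rfl | _
      · rwa [abs_neg, abs_of_pos hS0]
      · exact hRS.trans_le ((le_neg.1 ht.2).trans (neg_le_abs t))
    · rw [hG, ← hg0]
      refine intervalIntegral.integral_eq_integral_of_support_subset fun t ht => ?_
      by_contra h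
      apply ht
      apply hz
      rw [mem_Ioc, not_and_or, not_lt, not_le] at h
      rcases h with h | h
      · exact hRS.trans_le ((le_neg.1 h).trans (neg_le_abs t))
      · exact (hRS.trans (hx.trans h)).trans_le (le_abs_self t)
  have key := h G hGt
  rw [hGd'] at key
  have e : ∫ x, f x * g x = (∫ x, f x * φ x) - m * ∫ x, f x * ψ x := by
    rw [← integral_const_mul, ← integral_sub (hmul hφ) ((hmul hψt).const_mul m)]
    exact integral_congr_ae (Eventually.of_forall fun x => by simp only [hg]; ring)
  rw [integral_const_mul, ← hm]
  linear_combination key - e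

/-- Each `u ∈ H¹` has a continuous bounded representative. -/
theorem exists_boundedContinuous_rep (u : H1) :
    ∃ f : BoundedContinuousFunction ℝ ℂ, (u : L2) =ᵐ[volume] f := by
  set w : ℝ → ℂ := (weakDeriv u : ℝ → ℂ) with hwdef
  have hw : LocallyIntegrable w volume := (weakDeriv u).locallyIntegrable
  have hu : LocallyIntegrable ((u : L2) : ℝ → ℂ) volume := (u : L2).locallyIntegrable
  have hI : ∀ x y, IntervalIntegrable w volume x y := fun x y =>
    (hw.integrableOn_isCompact isCompact_uIcc).mono_set uIoc_subset_uIcc |> intervalIntegrable_iff.2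
  set U : ℝ → ℂ := fun x => ∫ t in (0 : ℝ)..x, w t with hU
  have hUc : Continuous U := intervalIntegral.continuous_primitive hI 0
  obtain ⟨c, hc⟩ := ae_const_of_weakDeriv_zero (hu.sub hUc.locallyIntegrable) fun φ hφ => by
    have h1 := weakDeriv_spec u φ hφ
    have h2 := isWeakDeriv_primitive hw φ hφ
    have i2 : Integrable (fun x => U x * deriv φ x) :=
      hUc.locallyIntegrable.integrable_smul_right_of_hasCompactSupport hφ.deriv.continuous
        hφ.deriv.2
    rw [← h2, ← sub_eq_zero, ← integral_sub ((u : L2).integrable_mul hφ.deriv) i2] at h1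
    rw [← h1]
    exact integral_congr_ae (Eventually.of_forall fun x => by
      simp only [Pi.sub_apply]; ring)
  set g : ℝ → ℂ := fun x => U x + c with hg
  have hgc : Continuous g := hUc.add continuous_const
  have hug : (u : L2) =ᵐ[volume] g := by
    filter_upwards [hc] with x hx
    simp only [Pi.sub_apply] at hx
    simp only [hg, ← hx]; ring
  have hsq : ∀ v : L2, Integrable (fun x => ‖(v : ℝ → ℂ) x‖ ^ 2) := fun v =>
    (Lp.memLp v).integrable_norm_pow (by norm_num)
  have hbd : ∀ {k : ℝ → ℂ}, LocallyIntegrable k volume → Integrable (fun x => ‖k x‖ ^ 2) → ∀ x : ℝ,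
      ∫ t in x..(x + 1), ‖k t‖ ≤ 1 + ∫ t, ‖k t‖ ^ 2 := by
    intro k hk hk2 x
    have hki : IntervalIntegrable (fun t => ‖k t‖) volume x (x + 1) :=
      ((hk.integrableOn_isCompact isCompact_uIcc).mono_set uIoc_subset_uIcc
        |> intervalIntegrable_iff.2).norm
    calc ∫ t in x..(x + 1), ‖k t‖ ≤ ∫ t in x..(x + 1), (1 + ‖k t‖ ^ 2) :=
          intervalIntegral.integral_mono_on (by linarith) hki
            (intervalIntegrable_const.add hk2.intervalIntegrable)
            (fun t _ => by nlinarith [sq_nonneg (‖k t‖ - 1), norm_nonneg (k t)])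
      _ = 1 + ∫ t in x..(x + 1), ‖k t‖ ^ 2 := by
          rw [intervalIntegral.integral_add intervalIntegrable_const hk2.intervalIntegrable]; simp
      _ ≤ _ := by
          gcongr
          rw [intervalIntegral.integral_of_le (by linarith)]
          exact setIntegral_le_integral hk2 (Eventually.of_forall fun t => by positivity)
  have hg2 : Integrable (fun x => ‖g x‖ ^ 2) :=
    (hsq u).congr (by filter_upwards [hug] with x hx; rw [hx])
  refine ⟨BoundedContinuousFunction.ofNormedAddCommGroup g hgc
    ((1 + ∫ t, ‖g t‖ ^ 2) + (1 + ∫ t, ‖w t‖ ^ 2)) fun x => ?_, hug⟩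
  have h1 : ∀ y ∈ Icc x (x + 1), ‖g x‖ ≤ ‖g y‖ + (1 + ∫ t, ‖w t‖ ^ 2) := by
    intro y hy
    have e : g x = g y - ∫ t in x..y, w t := by
      simp only [hg, hU]
      rw [← intervalIntegral.integral_interval_sub_left (hI 0 y) (hI 0 x)]; ring
    rw [e]
    refine (norm_sub_le _ _).trans ?_
    gcongr
    refine (intervalIntegral.norm_integral_le_integral_norm hy.1).trans
      (le_trans ?_ (hbd hw (hsq (weakDeriv u)) x))
    exact intervalIntegral.integral_mono_interval le_rfl hy.1 hy.2
      (Eventually.of_forall fun t => norm_nonneg _) (hI _ _).norm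
  have hgi : IntervalIntegrable (fun t => ‖g t‖) volume x (x + 1) :=
    hgc.norm.intervalIntegrable _ _
  calc ‖g x‖ = ∫ _ in x..(x + 1), ‖g x‖ := by simp
    _ ≤ ∫ y in x..(x + 1), (‖g y‖ + (1 + ∫ t, ‖w t‖ ^ 2)) :=
        intervalIntegral.integral_mono_on (by linarith) intervalIntegrable_const
          (hgi.add intervalIntegrable_const) h1
    _ = (∫ y in x..(x + 1), ‖g y‖) + (1 + ∫ t, ‖w t‖ ^ 2) := by
        rw [intervalIntegral.integral_add hgi intervalIntegrable_const]; simp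
    _ ≤ _ := by
        gcongr
        exact hbd hgc.locallyIntegrable hg2 x

theorem continuous_rep_unique {f g : BoundedContinuousFunction ℝ ℂ}
    (h : (f : ℝ → ℂ) =ᵐ[volume] g) : f = g :=
  DFunLike.coe_injective (Continuous.ae_eq_iff_eq volume f.continuous g.continuous |>.1 h)

/-- The continuous bounded representative `u_c` of `u ∈ H¹`; it is unique by
`continuous_rep_unique`. -/
def contRep : H1 →ₗ[ℂ] BoundedContinuousFunction ℝ ℂ where
  toFun u := (exists_boundedContinuous_rep u).choose
  map_add' u v := by
    refine continuous_rep_unique ?_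
    filter_upwards [(exists_boundedContinuous_rep (u + v)).choose_spec,
      (exists_boundedContinuous_rep u).choose_spec, (exists_boundedContinuous_rep v).choose_spec,
      Lp.coeFn_add (u : L2) (v : L2)] with x h1 h2 h3 h4
    rw [BoundedContinuousFunction.coe_add, Pi.add_apply, ← h1, ← h2, ← h3, Submodule.coe_add, h4,
      Pi.add_apply]
  map_smul' c u := by
    refine continuous_rep_unique ?_
    filter_upwards [(exists_boundedContinuous_rep (c • u)).choose_spec,
      (exists_boundedContinuous_rep u).choose_spec, Lp.coeFn_smul c (u : L2)] with x h1 h2 h3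
    rw [RingHom.id_apply, BoundedContinuousFunction.smul_apply, ← h1, ← h2,
      Submodule.coe_smul, h3, Pi.smul_apply]

theorem contRep_spec (u : H1) : (u : L2) =ᵐ[volume] contRep u :=
  (exists_boundedContinuous_rep u).choose_spec

/-- The integral of a bounded continuous function against a finite signed measure `V` is the
difference of its integrals against the positive and negative parts of `V`. -/
theorem integral_signed_eq (V : SignedMeasure ℝ) (f : BoundedContinuousFunction ℝ ℂ) :
    ∫ᵛ x, f x ∂<•V = (∫ x, f x ∂V.toJordanDecomposition.posPart)
      - ∫ x, f x ∂V.toJordanDecomposition.negPart := by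
  conv_lhs => rw [← SignedMeasure.toSignedMeasure_toJordanDecomposition V]
  rw [JordanDecomposition.toSignedMeasure, VectorMeasure.integral_sub_vectorMeasure]
  · simp
  · simpa [VectorMeasure.Integrable] using f.integrable _
  · simpa [VectorMeasure.Integrable] using f.integrable _

theorem integral_signed_add (V : SignedMeasure ℝ) (f g : BoundedContinuousFunction ℝ ℂ) :
    ∫ᵛ x, (f + g) x ∂<•V = (∫ᵛ x, f x ∂<•V) + ∫ᵛ x, g x ∂<•V := by
  rw [integral_signed_eq, integral_signed_eq, integral_signed_eq]
  simp only [BoundedContinuousFunction.add_apply]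
  rw [integral_add (f.integrable _) (g.integrable _), integral_add (f.integrable _) (g.integrable _)]
  ring

theorem integral_signed_smul (V : SignedMeasure ℝ) (c : ℂ) (f : BoundedContinuousFunction ℝ ℂ) :
    ∫ᵛ x, (c • f) x ∂<•V = c * ∫ᵛ x, f x ∂<•V := by
  rw [integral_signed_eq, integral_signed_eq]
  simp only [BoundedContinuousFunction.smul_apply, smul_eq_mul]
  rw [integral_const_mul, integral_const_mul]
  ring

/-- The distribution `P u = -h² u'' + u_c V` for `u ∈ H¹`, evaluated at a test function `φ`:
`-h² ∫ u φ'' dx + ∫ u_c φ dV`. -/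
def schrodingerDistribution (h : ℝ) (V : SignedMeasure ℝ) (u : H1) (φ : ℝ → ℂ) : ℂ :=
  -(h : ℂ) ^ 2 * (∫ x, (u : L2) x * deriv (deriv φ) x) + ∫ᵛ x, contRep u x * φ x ∂<•V

/-- The distribution `P u` is given by the function `f ∈ L²`. -/
def IsSchrodingerImage (h : ℝ) (V : SignedMeasure ℝ) (u : H1) (f : L2) : Prop :=
  ∀ φ : ℝ → ℂ, IsTestFunction φ → schrodingerDistribution h V u φ = ∫ x, f x * φ x

theorem IsTestFunction.exists_bounded {φ : ℝ → ℂ} (hφ : IsTestFunction φ) :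
    ∃ f : BoundedContinuousFunction ℝ ℂ, (f : ℝ → ℂ) = φ := by
  obtain ⟨C, hC⟩ := hφ.2.exists_bound_of_continuous hφ.continuous
  exact ⟨BoundedContinuousFunction.ofNormedAddCommGroup φ hφ.continuous C hC, rfl⟩

theorem schrodingerDistribution_add (h : ℝ) (V : SignedMeasure ℝ) (u v : H1) {φ : ℝ → ℂ}
    (hφ : IsTestFunction φ) : schrodingerDistribution h V (u + v) φ =
      schrodingerDistribution h V u φ + schrodingerDistribution h V v φ := by
  obtain ⟨b, rfl⟩ := hφ.exists_bounded
  have e := integral_signed_add V (contRep u * b) (contRep v * b)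
  rw [← add_mul, ← map_add] at e
  simp only [BoundedContinuousFunction.mul_apply] at e
  rw [schrodingerDistribution, e, Submodule.coe_add, L2.integral_add_mul _ _ hφ.deriv.deriv,
    schrodingerDistribution, schrodingerDistribution]
  ring

theorem schrodingerDistribution_smul (h : ℝ) (V : SignedMeasure ℝ) (c : ℂ) (u : H1) {φ : ℝ → ℂ}
    (hφ : IsTestFunction φ) : schrodingerDistribution h V (c • u) φ =
      c * schrodingerDistribution h V u φ := by
  obtain ⟨b, rfl⟩ := hφ.exists_bounded
  have e := integral_signed_smul V c (contRep u * b)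
  rw [← smul_mul_assoc, ← map_smul] at e
  simp only [BoundedContinuousFunction.mul_apply] at e
  rw [schrodingerDistribution, e, Submodule.coe_smul, L2.integral_smul_mul,
    schrodingerDistribution]
  ring

theorem IsSchrodingerImage.add {h : ℝ} {V : SignedMeasure ℝ} {u v : H1} {f g : L2}
    (hu : IsSchrodingerImage h V u f) (hv : IsSchrodingerImage h V v g) :
    IsSchrodingerImage h V (u + v) (f + g) := fun φ hφ => by
  rw [schrodingerDistribution_add h V u v hφ, hu φ hφ, hv φ hφ, L2.integral_add_mul _ _ hφ]

theorem IsSchrodingerImage.smul {h : ℝ} {V : SignedMeasure ℝ} {u : H1} {f : L2} (c : ℂ)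
    (hu : IsSchrodingerImage h V u f) : IsSchrodingerImage h V (c • u) (c • f) := fun φ hφ => by
  rw [schrodingerDistribution_smul h V c u hφ, hu φ hφ, L2.integral_smul_mul]

theorem IsSchrodingerImage.zero (h : ℝ) (V : SignedMeasure ℝ) :
    IsSchrodingerImage h V (0 : H1) (0 : L2) := fun φ hφ => by
  have e := schrodingerDistribution_smul h V 0 (0 : H1) hφ
  rw [zero_smul, zero_mul] at e
  rw [e, L2.integral_zero_mul]

theorem IsSchrodingerImage.unique {h : ℝ} {V : SignedMeasure ℝ} {u : H1} {f g : L2}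
    (hf : IsSchrodingerImage h V u f) (hg : IsSchrodingerImage h V u g) : f = g :=
  L2.ext_of_forall_test fun φ hφ => (hf φ hφ).symm.trans (hg φ hφ)

theorem memLp_top_add {f g : L2} (hf : MemLp f ∞ volume) (hg : MemLp g ∞ volume) :
    MemLp (f + g : L2) ∞ volume :=
  (memLp_congr_ae (Lp.coeFn_add f g)).2 (hf.add hg)

theorem memLp_top_smul (c : ℂ) {f : L2} (hf : MemLp f ∞ volume) :
    MemLp (c • f : L2) ∞ volume :=
  (memLp_congr_ae (Lp.coeFn_smul c f)).2 (hf.const_smul c)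

theorem memLp_top_zero : MemLp (0 : L2) ∞ volume :=
  (memLp_congr_ae (Lp.coeFn_zero ℂ 2 volume)).2 MemLp.zero

/-- The domain `𝒟 = {u ∈ H¹ : u' ∈ L^∞ and P u ∈ L²}`, as a subspace of `L²`. -/
def schrodingerDomain (h : ℝ) (V : SignedMeasure ℝ) : Submodule ℂ L2 where
  carrier := {u | ∃ w : H1, (w : L2) = u ∧
    MemLp (weakDeriv w) ∞ volume ∧ ∃ f : L2, IsSchrodingerImage h V w f}
  add_mem' := by
    rintro _ _ ⟨u, rfl, hu, f, hf⟩ ⟨v, rfl, hv, g, hg⟩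
    exact ⟨u + v, rfl, map_add weakDeriv u v ▸ memLp_top_add hu hv, f + g, hf.add hg⟩
  zero_mem' :=
    ⟨0, rfl, map_zero weakDeriv ▸ memLp_top_zero, 0, IsSchrodingerImage.zero h V⟩
  smul_mem' := by
    rintro c _ ⟨u, rfl, hu, f, hf⟩
    exact ⟨c • u, rfl, map_smul weakDeriv c u ▸ memLp_top_smul c hu, c • f, hf.smul c⟩

theorem exists_image_of_mem_domain {h : ℝ} {V : SignedMeasure ℝ} (u : schrodingerDomain h V) :
    ∃ f : L2, ∃ w : H1, (w : L2) = u ∧ IsSchrodingerImage h V w f := by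
  obtain ⟨w, hw, -, f, hf⟩ := u.2
  exact ⟨f, w, hw, hf⟩

theorem image_unique {h : ℝ} {V : SignedMeasure ℝ} {u f g : L2}
    (hf : ∃ w : H1, (w : L2) = u ∧ IsSchrodingerImage h V w f)
    (hg : ∃ w : H1, (w : L2) = u ∧ IsSchrodingerImage h V w g) : f = g := by
  obtain ⟨w, rfl, hf⟩ := hf
  obtain ⟨z, hz, hg⟩ := hg
  obtain rfl : z = w := Subtype.ext hz
  exact hf.unique hg

/-- The unbounded operator `P` on `L²` with domain `𝒟`; the value `P u` is the function in `L²`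
that gives the distribution `-h² u'' + u_c V` (see `schrodingerOperator_spec`), which is unique by
`IsSchrodingerImage.unique`. -/
def schrodingerOperator (h : ℝ) (V : SignedMeasure ℝ) : L2 →ₗ.[ℂ] L2 where
  domain := schrodingerDomain h V
  toFun :=
    { toFun := fun u => (exists_image_of_mem_domain u).choose
      map_add' := fun u v => by
        refine image_unique (exists_image_of_mem_domain (u + v)).choose_spec ?_
        obtain ⟨w, hw, hf⟩ := (exists_image_of_mem_domain u).choose_spec
        obtain ⟨z, hz, hg⟩ := (exists_image_of_mem_domain v).choose_spec
        exact ⟨w + z, by rw [Submodule.coe_add, hw, hz, Submodule.coe_add], hf.add hg⟩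
      map_smul' := fun c u => by
        refine image_unique (exists_image_of_mem_domain (c • u)).choose_spec ?_
        obtain ⟨w, hw, hf⟩ := (exists_image_of_mem_domain u).choose_spec
        exact ⟨c • w, by rw [Submodule.coe_smul, hw, Submodule.coe_smul], hf.smul c⟩ }

theorem schrodingerOperator_spec (h : ℝ) (V : SignedMeasure ℝ) (u : schrodingerDomain h V) :
    ∃ w : H1, (w : L2) = u ∧ IsSchrodingerImage h V w (schrodingerOperator h V u) :=
  (exists_image_of_mem_domain u).choose_spec

/-- The form `q(u, v) = ∫ h² conj(u') v' dx + ∫ conj(u_c) v_c dV` on `H¹`, conjugate linear in `u`. -/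
def schrodingerForm (h : ℝ) (V : SignedMeasure ℝ) : H1 →ₗ⋆[ℂ] H1 →ₗ[ℂ] ℂ :=
  LinearMap.mk₂'ₛₗ (starRingEnd ℂ) (RingHom.id ℂ)
    (fun u v => (h : ℂ) ^ 2 * inner ℂ (weakDeriv u) (weakDeriv v)
      + ∫ᵛ x, conj (contRep u x) * contRep v x ∂<•V)
    (fun u v w => by
      have e := integral_signed_add V (star (contRep u) * contRep w) (star (contRep v) * contRep w)
      rw [← add_mul, ← star_add, ← map_add] at e
      simp only [BoundedContinuousFunction.mul_apply, BoundedContinuousFunction.star_apply,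
        RCLike.star_def] at e
      rw [e, map_add, inner_add_left]
      ring)
    (fun c u v => by
      have e := integral_signed_smul V (conj c) (star (contRep u) * contRep v)
      rw [← smul_mul_assoc, ← RCLike.star_def, ← star_smul, ← map_smul] at e
      simp only [BoundedContinuousFunction.mul_apply, BoundedContinuousFunction.star_apply,
        RCLike.star_def] at e
      rw [e, map_smul, inner_smul_left, smul_eq_mul]
      ring)
    (fun u v w => by
      have e := integral_signed_add V (star (contRep u) * contRep v) (star (contRep u) * contRep w)
      rw [← mul_add, ← map_add] at e
      simp only [BoundedContinuousFunction.mul_apply, BoundedContinuousFunction.star_apply,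
        RCLike.star_def] at e
      rw [e, map_add, inner_add_right]
      ring)
    (fun c u v => by
      have e := integral_signed_smul V c (star (contRep u) * contRep v)
      rw [← mul_smul_comm, ← map_smul] at e
      simp only [BoundedContinuousFunction.mul_apply, BoundedContinuousFunction.star_apply,
        RCLike.star_def] at e
      rw [e, map_smul, inner_smul_right, RingHom.id_apply, smul_eq_mul]
      ring)

section Forms

variable {H : Type*} [NormedAddCommGroup H] [InnerProductSpace ℂ H] {Q : Submodule ℂ H}

/-- The form `q`, with domain `Q`, is bounded from below: `q(u, u) ≥ γ ‖u‖²` for some real `γ`. -/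
def FormSemibounded (q : Q →ₗ⋆[ℂ] Q →ₗ[ℂ] ℂ) : Prop :=
  ∃ γ : ℝ, ∀ u : Q, γ * ‖u‖ ^ 2 ≤ (q u u).re

/-- The semibounded form `q`, with domain `Q`, is closed: if `u n ∈ Q` converges to `v` in `H` and
`q(u n - u m, u n - u m) → 0` as `n, m → ∞`, then `v ∈ Q` and `q(u n - v, u n - v) → 0`. -/
def FormClosed (q : Q →ₗ⋆[ℂ] Q →ₗ[ℂ] ℂ) : Prop :=
  ∀ (u : ℕ → Q) (v : H), Tendsto (fun n => (u n : H)) atTop (𝓝 v) →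
    Tendsto (fun p : ℕ × ℕ => q (u p.1 - u p.2) (u p.1 - u p.2)) atTop (𝓝 0) →
    ∃ hv : v ∈ Q, Tendsto (fun n => q (u n - ⟨v, hv⟩) (u n - ⟨v, hv⟩)) atTop (𝓝 0)

/-- `A` is the operator associated with the form `q`: its domain is the set of all `u ∈ Q` for which
there is `f ∈ H` with `q(u, v) = ⟪f, v⟫` for all `v ∈ Q`, and then `A u = f`. -/
def IsOperatorOfForm (q : Q →ₗ⋆[ℂ] Q →ₗ[ℂ] ℂ) (A : H →ₗ.[ℂ] H) : Prop :=
  ∀ u f : H, (u, f) ∈ A.graph ↔ ∃ hu : u ∈ Q, ∀ v : Q, q ⟨u, hu⟩ v = inner ℂ f (v : H)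

end Forms

end

end MeasureSchrodinger

namespace MeasureSchrodinger

noncomputable section

open MeasureTheory Filter Topology Set
open scoped ContDiff ENNReal ComplexConjugate

/-! ### Closed semibounded forms and their operators on an abstract Hilbert space. -/

section Forms

variable {H : Type*} [NormedAddCommGroup H] [InnerProductSpace ℂ H]

/-! The operator is studied through its form. For every `s > 0` the Sobolev inequality bounds
`‖u_c‖_∞` by `s⁻¹ ‖u‖ + s ‖u'‖` (`norm_contRep_apply_le`). As `V` has finite total mass, a small `s`
lets half of the kinetic energy absorb the potential term, at the cost of a multiple of `‖u‖²`
(`exists_garding`). Hence `q` is semibounded. A sequence that is Cauchy both in `L²` and for `q` is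
therefore Cauchy in `H¹`, and `q` is closed because the weak derivative is closed. Symmetry holds
because `V` is real.

The rest of the functional analysis is abstract. Some shift `q + l⟪·,·⟫` is an inner product for
which the form domain is complete, so the Riesz theorem makes `A + l` surjective
(`IsOperatorOfForm.exists_shift_surjective`). A symmetric operator with a surjective real shift is
self-adjoint once it is densely defined, and density follows from the same surjectivity.

It remains to see that `P` is the operator of `q`. The distributional equation `P u = f` says, up to
conjugation, that `q(u, ·) = ⟪f, ·⟫` on test functions. Since these are dense in `H¹`, the identity
extends to all of `H¹` (`isSchrodingerImage_iff`). The requirement `u' ∈ L^∞` in the domain costs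
nothing: if `G` is the bounded distribution function of `u_c V`, then `h² u' - G` has weak
derivative `-f ∈ L²` and bounded averages over unit intervals, so it is bounded
(`IsSchrodingerImage.memLp_top_weakDeriv`). -/

theorem inner_self_re (x : H) : (inner ℂ x x).re = ‖x‖ ^ 2 := inner_self_eq_norm_sq (𝕜 := ℂ) x

/-- Riesz representation of the functionals `v ↦ ⟪f, J v⟫` in a space `F` with an inner product
that dominates the one of `H` along `J` and that is complete relative to `H`. -/
theorem exists_core_inner_eq [CompleteSpace H] {F : Type*} [AddCommGroup F] [Module ℂ F]
    (c : InnerProductSpace.Core ℂ F) (J : F →ₗ[ℂ] H)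
    (hJ : ∀ u, ‖J u‖ ^ 2 ≤ (c.inner u u).re)
    (hc : ∀ (u : ℕ → F) (v : H), Tendsto (fun n => J (u n)) atTop (𝓝 v) →
      Tendsto (fun p : ℕ × ℕ => (c.inner (u p.1 - u p.2) (u p.1 - u p.2)).re) atTop (𝓝 0) →
      ∃ w, Tendsto (fun n => (c.inner (u n - w) (u n - w)).re) atTop (𝓝 0)) (f : H) :
    ∃ u : F, ∀ v, c.inner u v = inner ℂ f (J v) := by
  let : NormedAddCommGroup F := c.toNormedAddCommGroup
  let : InnerProductSpace ℂ F := InnerProductSpace.ofCore c.toCore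
  have hnorm : ∀ u : F, ‖u‖ ^ 2 = (c.inner u u).re := fun u =>
    (inner_self_eq_norm_sq (𝕜 := ℂ) u).symm
  have hJ' : ∀ u, ‖J u‖ ≤ 1 * ‖u‖ := fun u => by
    rw [one_mul]
    exact le_of_sq_le_sq ((hJ u).trans_eq (hnorm u).symm) (norm_nonneg _)
  let Jc : F →L[ℂ] H := J.mkContinuous 1 hJ'
  have : CompleteSpace F := by
    -- `J` is a contraction, so a Cauchy sequence in `F` has a convergent image in `H`, and `hc`
    -- then supplies a limit in `F`.
    refine Metric.complete_of_cauchySeq_tendsto fun u hu => ?_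
    obtain ⟨v, hv⟩ := cauchySeq_tendsto_of_complete (Jc.uniformContinuous.comp_cauchySeq hu)
    obtain ⟨w, hw⟩ := hc u v hv (by
      simp only [← hnorm]
      have h1 := cauchySeq_iff_tendsto_dist_atTop_0.1 hu
      have h2 := h1.pow 2
      simpa [dist_eq_norm] using h2)
    refine ⟨w, ?_⟩
    rw [tendsto_iff_norm_sub_tendsto_zero]
    simp only [← hnorm] at hw
    have h3 := hw.sqrt
    simpa using h3
  refine ⟨(InnerProductSpace.toDual ℂ F).symm ((innerSL ℂ f).comp Jc), fun v => ?_⟩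
  exact InnerProductSpace.toDual_symm_apply (𝕜 := ℂ) (E := F)

variable {Q : Submodule ℂ H} {q : Q →ₗ⋆[ℂ] Q →ₗ[ℂ] ℂ}

/-- The positive definite form `q + (1 - γ) ⟪·, ·⟫` of a symmetric form `q ≥ γ`. -/
@[reducible] def formCore (hs : q.IsSymm) {γ : ℝ} (hγ : ∀ u : Q, γ * ‖u‖ ^ 2 ≤ (q u u).re) :
    InnerProductSpace.Core ℂ Q where
  inner u v := q u v + (1 - γ : ℝ) * inner ℂ (u : H) v
  conj_inner_symm u v := by
    rw [map_add, map_mul, hs.eq, Complex.conj_ofReal, inner_conj_symm]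
  re_inner_nonneg u := by
    have h1 := hγ u
    rw [Submodule.coe_norm] at h1
    simp only [RCLike.re_to_complex, Complex.add_re, Complex.re_ofReal_mul, inner_self_re]
    nlinarith [sq_nonneg ‖(u : H)‖]
  add_left u v w := by
    rw [map_add, LinearMap.add_apply, Submodule.coe_add, inner_add_left]; ring
  smul_left u v r := by
    rw [LinearMap.map_smulₛₗ, LinearMap.smul_apply, Submodule.coe_smul, inner_smul_left,
      smul_eq_mul]
    ring
  definite u h := by
    have h1 := hγ u
    have h2 := congrArg Complex.re h
    rw [Submodule.coe_norm] at h1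
    simp only [Complex.add_re, Complex.re_ofReal_mul, inner_self_re] at h2
    have h3 : ‖(u : H)‖ ^ 2 = 0 := by
      refine le_antisymm ?_ (sq_nonneg _)
      simp only [Complex.zero_re] at h2
      linarith
    simpa using h3

theorem formCore_inner_self_re (hs : q.IsSymm) {γ : ℝ}
    (hγ : ∀ u : Q, γ * ‖u‖ ^ 2 ≤ (q u u).re) (u : Q) :
    ((formCore hs hγ).inner u u).re = (q u u).re + (1 - γ) * ‖(u : H)‖ ^ 2 := by
  change (q u u + (1 - γ : ℝ) * inner ℂ (u : H) u).re = _
  rw [Complex.add_re, Complex.re_ofReal_mul, inner_self_re]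

theorem form_apply_self_eq_re (hs : q.IsSymm) (u : Q) : q u u = ((q u u).re : ℂ) :=
  (Complex.conj_eq_iff_re.1 (hs.eq u u)).symm

/-- A shift of a closed semibounded symmetric form represents every functional `⟪f, ·⟫`. -/
theorem FormClosed.exists_shift_eq [CompleteSpace H] (hs : q.IsSymm) (hsb : FormSemibounded q)
    (hcl : FormClosed q) :
    ∃ l : ℝ, (∀ u : Q, ‖u‖ ^ 2 ≤ (q u u).re + l * ‖u‖ ^ 2) ∧
      ∀ f : H, ∃ u : Q, ∀ v : Q, q u v + l * inner ℂ (u : H) v = inner ℂ f (v : H) := by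
  obtain ⟨γ, hγ⟩ := hsb
  -- The shift `1 - γ` raises the lower bound from `γ` to exactly `1`.
  refine ⟨1 - γ, fun u => by linarith [hγ u], fun f => ?_⟩
  refine exists_core_inner_eq (formCore hs hγ) Q.subtype (fun u => ?_) (fun u v hu hq => ?_) f
  · rw [formCore_inner_self_re]
    have h1 := hγ u
    rw [Submodule.coe_norm] at h1
    simp only [Submodule.subtype_apply]
    linarith
  · simp only [Submodule.subtype_apply] at hu
    simp only [formCore_inner_self_re] at hq ⊢
    have hd : Tendsto (fun p : ℕ × ℕ => ‖((u p.1 - u p.2 : Q) : H)‖ ^ 2) atTop (𝓝 0) := by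
      have h1 := (cauchySeq_iff_tendsto_dist_atTop_0.1 hu.cauchySeq).pow 2
      simpa [dist_eq_norm] using h1
    have hq' : Tendsto (fun p : ℕ × ℕ => q (u p.1 - u p.2) (u p.1 - u p.2)) atTop (𝓝 0) := by
      have h1 := hq.sub (hd.const_mul (1 - γ))
      simp only [add_sub_cancel_right, mul_zero, sub_zero] at h1
      -- A symmetric form is real on the diagonal, so convergence of the real parts suffices.
      have h2 := (Complex.continuous_ofReal.tendsto 0).comp h1
      refine (h2.congr fun p => ?_).trans (by simp)
      exact (form_apply_self_eq_re hs _).symm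
    obtain ⟨hv, hlim⟩ := hcl u v hu hq'
    refine ⟨⟨v, hv⟩, ?_⟩
    have h1 := (Complex.continuous_re.tendsto 0).comp hlim
    have h2 : Tendsto (fun n => ‖((u n - ⟨v, hv⟩ : Q) : H)‖ ^ 2) atTop (𝓝 0) := by
      simpa using (tendsto_iff_norm_sub_tendsto_zero.1 hu).pow 2
    simpa using h1.add (h2.const_mul (1 - γ))

variable {A : H →ₗ.[ℂ] H}

theorem IsOperatorOfForm.exists_apply_eq (hA : IsOperatorOfForm q A) (x : A.domain) :
    ∃ hx : (x : H) ∈ Q, ∀ v : Q, q ⟨x, hx⟩ v = inner ℂ (A x) (v : H) :=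
  (hA _ _).1 (A.mem_graph x)

theorem IsOperatorOfForm.inner_apply_left (hA : IsOperatorOfForm q A) (hs : q.IsSymm)
    (x y : A.domain) : inner ℂ (A x) (y : H) = inner ℂ (x : H) (A y) := by
  obtain ⟨hx, hqx⟩ := hA.exists_apply_eq x
  obtain ⟨hy, hqy⟩ := hA.exists_apply_eq y
  have e1 := hqx ⟨y, hy⟩
  have e2 := hqy ⟨x, hx⟩
  rw [← inner_conj_symm (x : H), ← e1, ← e2, hs.eq]

/-- Some real shift of the operator associated with a closed semibounded symmetric form
is onto. -/
theorem IsOperatorOfForm.exists_shift_surjective [CompleteSpace H] (hA : IsOperatorOfForm q A)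
    (hs : q.IsSymm) (hsb : FormSemibounded q) (hcl : FormClosed q) :
    ∃ l : ℝ, (∀ u : Q, ‖u‖ ^ 2 ≤ (q u u).re + l * ‖u‖ ^ 2) ∧
      ∀ f : H, ∃ x : A.domain, A x + (l : ℂ) • (x : H) = f := by
  obtain ⟨l, hl, hsurj⟩ := FormClosed.exists_shift_eq hs hsb hcl
  refine ⟨l, hl, fun f => ?_⟩
  obtain ⟨u, hu⟩ := hsurj f
  have hg : ((u : H), f - (l : ℂ) • (u : H)) ∈ A.graph := by
    refine (hA _ _).2 ⟨u.2, fun v => ?_⟩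
    rw [inner_sub_left, ← hu v, inner_smul_left, Complex.conj_ofReal]
    ring
  obtain ⟨x, hx, hAx⟩ := (A.mem_graph_iff).1 hg
  exact ⟨x, by rw [hAx, hx, sub_add_cancel]⟩

/-- Let `f` be orthogonal to the domain and solve `(A + l) u = f`. Pairing with `u` gives `0 = q(u,
u) + l ‖u‖² ≥ ‖u‖²`, so `u = 0` and `f = 0`. -/
theorem IsOperatorOfForm.dense_domain [CompleteSpace H] (hA : IsOperatorOfForm q A)
    (hs : q.IsSymm) (hsb : FormSemibounded q) (hcl : FormClosed q) :
    Dense (A.domain : Set H) := by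
  obtain ⟨l, hl, hsurj⟩ := hA.exists_shift_surjective hs hsb hcl
  rw [Submodule.dense_iff_topologicalClosure_eq_top, Submodule.topologicalClosure_eq_top_iff,
    Submodule.eq_bot_iff]
  intro f hf
  obtain ⟨u, hu⟩ := hsurj f
  obtain ⟨hQu, hqu⟩ := hA.exists_apply_eq u
  have h0 := Submodule.inner_left_of_mem_orthogonal u.2 hf
  have e : inner ℂ (A u) (u : H) + l * inner ℂ (u : H) (u : H) = 0 := by
    rw [← h0, ← hu, inner_add_left, inner_smul_left, Complex.conj_ofReal]
  rw [← hqu ⟨u, hQu⟩] at e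
  have e' := congrArg Complex.re e
  rw [Complex.add_re, Complex.re_ofReal_mul, inner_self_re, Complex.zero_re] at e'
  have h1 := hl ⟨u, hQu⟩
  rw [Submodule.coe_norm] at h1
  have h2 : (u : H) = 0 := by
    have : ‖(u : H)‖ ^ 2 = 0 := le_antisymm (h1.trans_eq e') (sq_nonneg _)
    simpa using this
  have h3 : u = 0 := Subtype.ext h2
  rw [← hu, h3]
  simp

/-- The operator associated with a densely defined closed semibounded symmetric form is
self-adjoint. -/
theorem IsOperatorOfForm.isSelfAdjoint [CompleteSpace H] (hA : IsOperatorOfForm q A)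
    (hs : q.IsSymm) (hsb : FormSemibounded q) (hcl : FormClosed q) :
    IsSelfAdjoint A := by
  have hd := hA.dense_domain hs hsb hcl
  obtain ⟨l, -, hsurj⟩ := hA.exists_shift_surjective hs hsb hcl
  have hle : A ≤ A.adjoint :=
    LinearPMap.IsFormalAdjoint.le_adjoint hd fun x y => hA.inner_apply_left hs x y
  rw [LinearPMap.isSelfAdjoint_def]
  refine (LinearPMap.eq_of_le_of_domain_eq hle (le_antisymm hle.1 fun y hy => ?_)).symm
  -- For `y` in the domain of the adjoint, `u` solves `(A + l) u = (A* + l) y`; the claim becomes `y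
  -- = u`.
  obtain ⟨u, hu⟩ := hsurj (A.adjoint ⟨y, hy⟩ + (l : ℂ) • y)
  suffices y = u by rw [this]; exact u.2
  rw [← sub_eq_zero]
  -- By the choice of `u`, `y - u` is orthogonal to the range of `A + l`. That range contains `y -
  -- u` itself, which therefore vanishes.
  obtain ⟨x, hx⟩ := hsurj (y - u)
  rw [← inner_self_eq_zero (𝕜 := ℂ)]
  have e1 := LinearPMap.adjoint_isFormalAdjoint hd ⟨y, hy⟩ x
  have e2 := hA.inner_apply_left hs u x
  have e3 := congrArg (fun z => inner ℂ z (x : H)) hu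
  simp only [inner_add_left, inner_smul_left, Complex.conj_ofReal] at e3
  nth_rewrite 2 [← hx]
  rw [inner_sub_left, inner_add_right, inner_add_right, inner_smul_right, inner_smul_right]
  linear_combination e2 - e1 - e3

end Forms

/-! ### Primitives and the Sobolev inequality. -/

theorem intervalIntegrable_of_locallyIntegrable {w : ℝ → ℂ} (hw : LocallyIntegrable w volume)
    (x y : ℝ) : IntervalIntegrable w volume x y :=
  (hw.integrableOn_isCompact isCompact_uIcc).mono_set uIoc_subset_uIcc |> intervalIntegrable_iff.2

theorem continuous_primitive {w : ℝ → ℂ} (hw : LocallyIntegrable w volume) :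
    Continuous fun x => ∫ t in (0 : ℝ)..x, w t :=
  intervalIntegral.continuous_primitive (intervalIntegrable_of_locallyIntegrable hw) 0

/-- A locally integrable function is, up to a constant, a primitive of its weak derivative. -/
theorem IsWeakDeriv.exists_ae_eq_primitive {f w : ℝ → ℂ} (hf : LocallyIntegrable f volume)
    (hw : LocallyIntegrable w volume) (h : IsWeakDeriv f w) :
    ∃ c : ℂ, f =ᵐ[volume] fun x => (∫ t in (0 : ℝ)..x, w t) + c := by
  have hUl := (continuous_primitive hw).locallyIntegrable (μ := volume)
  obtain ⟨c, hc⟩ := ae_const_of_weakDeriv_zero (hf.sub hUl) fun φ hφ => by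
    have i1 : Integrable (fun x => f x * deriv φ x) :=
      hf.integrable_smul_right_of_hasCompactSupport hφ.deriv.continuous hφ.deriv.2
    have i2 : Integrable (fun x => (∫ t in (0 : ℝ)..x, w t) * deriv φ x) :=
      hUl.integrable_smul_right_of_hasCompactSupport hφ.deriv.continuous hφ.deriv.2
    simp only [Pi.sub_apply, sub_mul]
    rw [integral_sub i1 i2, h φ hφ, isWeakDeriv_primitive hw φ hφ, sub_self]
  refine ⟨c, ?_⟩
  filter_upwards [hc] with x hx
  rw [← hx, Pi.sub_apply]
  ring

theorem contRep_sub_contRep (u : H1) (x y : ℝ) :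
    contRep u y - contRep u x = ∫ t in x..y, weakDeriv u t := by
  have hw := (weakDeriv u).locallyIntegrable
  obtain ⟨c, hc⟩ := (weakDeriv_spec u).exists_ae_eq_primitive (u : L2).locallyIntegrable hw
  have e := (Continuous.ae_eq_iff_eq volume (contRep u).continuous
    ((continuous_primitive hw).add continuous_const)).1 ((contRep_spec u).symm.trans hc)
  have hI := intervalIntegrable_of_locallyIntegrable hw
  rw [e, ← intervalIntegral.integral_interval_sub_left (hI 0 y) (hI 0 x)]
  simp only [Pi.add_apply]
  ring

/-- Cauchy–Schwarz against the indicator of the interval, whose norm is `√(y - x)`. -/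
theorem norm_intervalIntegral_le (w : L2) {x y : ℝ} (hxy : x ≤ y) :
    ‖∫ t in x..y, w t‖ ≤ √(y - x) * ‖w‖ := by
  have hs : (volume : Measure ℝ) (Ioc x y) ≠ ⊤ := measure_Ioc_lt_top.ne
  rw [intervalIntegral.integral_of_le hxy,
    ← MeasureTheory.L2.inner_indicatorConstLp_one measurableSet_Ioc hs w]
  refine (norm_inner_le_norm _ _).trans ?_
  gcongr
  refine norm_indicatorConstLp_le.trans_eq ?_
  rw [Real.sqrt_eq_rpow]
  simp [hxy]

/-- A pointwise bound in terms of a bound for local averages and a Hölder bound. -/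
theorem norm_le_of_norm_intervalIntegral_le {g : ℝ → ℂ} (hg : Continuous g) {B C s : ℝ}
    (hs : 0 < s) (hC : ∀ x y, x ≤ y → ‖g y - g x‖ ≤ √(y - x) * C) (x : ℝ)
    (hB : ‖∫ t in x..(x + s ^ 2), g t‖ ≤ s * B) : ‖g x‖ ≤ s⁻¹ * B + s * C := by
  have hC0 : 0 ≤ C := by simpa using (norm_nonneg _).trans (hC 0 1 zero_le_one)
  -- Compare `g x` with its average over a window of length `s²`: inside the window `g` differs from
  -- `g x` by at most `√(s²) C = s C`.
  have e : ((s ^ 2 : ℝ) : ℂ) * g x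
      = (∫ t in x..(x + s ^ 2), g t) - ∫ t in x..(x + s ^ 2), (g t - g x) := by
    rw [intervalIntegral.integral_sub (hg.intervalIntegrable _ _) intervalIntegrable_const]
    simp
  have h1 : ‖∫ t in x..(x + s ^ 2), (g t - g x)‖ ≤ (s * C) * |x + s ^ 2 - x| := by
    refine intervalIntegral.norm_integral_le_of_norm_le_const fun t ht => ?_
    rw [uIoc_of_le (by nlinarith), mem_Ioc] at ht
    refine (hC x t ht.1.le).trans ?_
    gcongr
    rw [Real.sqrt_le_left hs.le]
    linarith
  have h2 : s ^ 2 * ‖g x‖ ≤ s * B + s * C * s ^ 2 := by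
    calc s ^ 2 * ‖g x‖ = ‖((s ^ 2 : ℝ) : ℂ) * g x‖ := by
          rw [norm_mul, Complex.norm_real, Real.norm_of_nonneg (sq_nonneg s)]
      _ ≤ _ := by
          rw [e]
          refine (norm_sub_le _ _).trans (add_le_add hB (h1.trans_eq ?_))
          rw [add_sub_cancel_left, abs_of_nonneg (sq_nonneg s)]
  have h3 : s ^ 2 * (s⁻¹ * B + s * C) = s * B + s * C * s ^ 2 := by
    field_simp
  exact le_of_mul_le_mul_left (h2.trans_eq h3.symm) (by positivity)

/-- The Sobolev inequality `‖u‖_∞ ≤ s⁻¹ ‖u‖ + s ‖u'‖`. -/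
theorem norm_contRep_apply_le (u : H1) {s : ℝ} (hs : 0 < s) (x : ℝ) :
    ‖contRep u x‖ ≤ s⁻¹ * ‖(u : L2)‖ + s * ‖weakDeriv u‖ := by
  refine norm_le_of_norm_intervalIntegral_le (contRep u).continuous hs (fun x y hxy => ?_) x ?_
  · rw [contRep_sub_contRep]
    exact norm_intervalIntegral_le _ hxy
  · have h1 := norm_intervalIntegral_le (u : L2) (x := x) (y := x + s ^ 2) (by nlinarith)
    rw [add_sub_cancel_left, Real.sqrt_sq hs.le] at h1
    rwa [intervalIntegral.integral_congr_ae
      ((contRep_spec u).mono fun t ht _ => ht)] at h1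

/-! ### Test functions as elements of `L²` and `H¹`. -/

section TestFunctions

variable {φ ψ : ℝ → ℂ}

theorem IsTestFunction.memLp (hφ : IsTestFunction φ) : MemLp φ 2 volume :=
  hφ.continuous.memLp_of_hasCompactSupport hφ.2

/-- A test function as an element of `L²`. -/
def IsTestFunction.toL2 (hφ : IsTestFunction φ) : L2 := hφ.memLp.toLp φ

theorem IsTestFunction.coeFn_toL2 (hφ : IsTestFunction φ) : hφ.toL2 =ᵐ[volume] φ :=
  hφ.memLp.coeFn_toLp

theorem IsTestFunction.conj (hφ : IsTestFunction φ) : IsTestFunction fun x => conj (φ x) :=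
  ⟨Complex.conjCLE.contDiff.comp hφ.1, hφ.2.comp_left (map_zero _)⟩

theorem IsTestFunction.differentiable (hφ : IsTestFunction φ) : Differentiable ℝ φ :=
  hφ.1.differentiable (by simp)

theorem IsTestFunction.deriv_conj (hφ : IsTestFunction φ) :
    _root_.deriv (fun x => conj (φ x)) = fun x => conj (_root_.deriv φ x) :=
  funext fun x => ((hφ.differentiable x).hasDerivAt.star).deriv

theorem IsTestFunction.add (hφ : IsTestFunction φ) (hψ : IsTestFunction ψ) :
    IsTestFunction (φ + ψ) := ⟨hφ.1.add hψ.1, hφ.2.add hψ.2⟩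

theorem IsTestFunction.const_smul (c : ℂ) (hφ : IsTestFunction φ) : IsTestFunction (c • φ) :=
  ⟨hφ.1.const_smul c, hφ.2.smul_left (f := fun _ => c)⟩

theorem isTestFunction_zero : IsTestFunction 0 := ⟨contDiff_const, HasCompactSupport.zero⟩

theorem IsTestFunction.integrable_mul (hφ : IsTestFunction φ) (hψ : IsTestFunction ψ) :
    Integrable fun x => φ x * ψ x :=
  hφ.continuous.locallyIntegrable.integrable_smul_right_of_hasCompactSupport hψ.continuous hψ.2

theorem IsTestFunction.isWeakDeriv (hφ : IsTestFunction φ) : IsWeakDeriv φ (_root_.deriv φ) :=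
  fun _ hψ => integral_mul_deriv_eq_deriv_mul_of_integrable
    (fun x _ => (hφ.differentiable x).hasDerivAt) (fun x _ => (hψ.differentiable x).hasDerivAt)
    (hφ.integrable_mul hψ.deriv) (hφ.deriv.integrable_mul hψ) (hφ.integrable_mul hψ)

theorem IsWeakDeriv.congr {u u' w w' : ℝ → ℂ} (h : IsWeakDeriv u w) (hu : u' =ᵐ[volume] u)
    (hw : w' =ᵐ[volume] w) : IsWeakDeriv u' w' := fun φ hφ => by
  rw [integral_congr_ae (g := fun x => u x * deriv φ x) (hu.mono fun x hx => by simp only [hx]),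
    integral_congr_ae (f := fun x => w' x * φ x) (g := fun x => w x * φ x)
      (hw.mono fun x hx => by simp only [hx]), h φ hφ]

theorem IsTestFunction.isWeakDeriv_toL2 (hφ : IsTestFunction φ) :
    IsWeakDeriv hφ.toL2 hφ.deriv.toL2 :=
  hφ.isWeakDeriv.congr hφ.coeFn_toL2 hφ.deriv.coeFn_toL2

/-- A test function as an element of `H¹`. -/
def IsTestFunction.toH1 (hφ : IsTestFunction φ) : H1 :=
  ⟨hφ.toL2, hφ.deriv.toL2, hφ.isWeakDeriv_toL2⟩

theorem weakDeriv_eq_of_isWeakDeriv {u : H1} {w : L2} (h : IsWeakDeriv (u : L2) w) :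
    weakDeriv u = w := (weakDeriv_spec u).unique h

theorem IsTestFunction.weakDeriv_toH1 (hφ : IsTestFunction φ) :
    weakDeriv hφ.toH1 = hφ.deriv.toL2 :=
  weakDeriv_eq_of_isWeakDeriv hφ.isWeakDeriv_toL2

theorem contRep_eq_of_ae_eq {u : H1} {f : ℝ → ℂ} (hf : Continuous f) (h : (u : L2) =ᵐ[volume] f) :
    (contRep u : ℝ → ℂ) = f :=
  (Continuous.ae_eq_iff_eq volume (contRep u).continuous hf).1 ((contRep_spec u).symm.trans h)

theorem IsTestFunction.contRep_toH1 (hφ : IsTestFunction φ) : (contRep hφ.toH1 : ℝ → ℂ) = φ :=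
  contRep_eq_of_ae_eq hφ.continuous hφ.coeFn_toL2

theorem IsTestFunction.inner_toL2_left (hφ : IsTestFunction φ) (f : L2) :
    inner ℂ hφ.toL2 f = ∫ x, f x * conj (φ x) := by
  rw [MeasureTheory.L2.inner_def]
  refine integral_congr_ae ?_
  filter_upwards [hφ.coeFn_toL2] with x hx
  rw [hx, RCLike.inner_apply]

theorem integral_mul_eq_inner (hφ : IsTestFunction φ) (f : L2) :
    ∫ x, f x * φ x = inner ℂ hφ.conj.toL2 f := by
  simp [hφ.conj.inner_toL2_left]

end TestFunctions

/-! ### Density of test functions in `H¹` and closedness of the weak derivative. -/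

/-- An `L²` solution of `f' = c f` with `c ≠ 0` vanishes. -/
theorem eq_zero_of_isWeakDeriv_smul {f : L2} {c : ℝ} (hc : c ≠ 0)
    (h : IsWeakDeriv f ((c : ℂ) • f : L2)) : f = 0 := by
  -- Integrating factor: `f E` has vanishing weak derivative, so `f` is a multiple of `exp (c x)`.
  let E : ℝ → ℂ := fun x => Complex.exp (-(c * x : ℝ))
  have hE : ContDiff ℝ ∞ E := by
    refine Complex.contDiff_exp.comp ?_
    exact (Complex.ofRealCLM.contDiff.comp (contDiff_const.mul contDiff_id)).neg
  have hEd : ∀ x, HasDerivAt E (-c * E x) x := fun x => by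
    have h1 : HasDerivAt (fun x : ℝ => (-(c * x : ℝ) : ℂ)) (-c) x := by
      have := (((hasDerivAt_id x).const_mul c).ofReal_comp).neg
      rw [mul_one] at this
      exact this
    have := h1.cexp
    rwa [mul_comm] at this
  have hEl : LocallyIntegrable (fun x => f x * E x) volume :=
    locallyIntegrable_iff.2 fun K hK =>
      (f.locallyIntegrable.integrableOn_isCompact hK).mul_continuousOn hE.continuous.continuousOn hK
  obtain ⟨k, hk⟩ := ae_const_of_weakDeriv_zero hEl fun φ hφ => by
    have hEφ : IsTestFunction (E * φ) := ⟨hE.mul hφ.1, hφ.2.mul_left⟩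
    have hd : deriv (E * φ) = fun x => E x * deriv φ x - c * (E * φ) x := funext fun x => by
      rw [((hEd x).mul (hφ.differentiable x).hasDerivAt).deriv, Pi.mul_apply]
      ring
    have e := h _ hEφ
    rw [hd, MeasureSchrodinger.L2.integral_smul_mul] at e
    have i1 : Integrable fun x => f x * (E x * deriv φ x) :=
      f.integrable_mul (φ := E * deriv φ) ⟨hE.mul hφ.deriv.1, hφ.deriv.2.mul_left⟩
    have i2 := f.integrable_mul hEφ
    have e2 : ∫ x, f x * (E x * deriv φ x - c * (E * φ) x)
        = (∫ x, f x * (E x * deriv φ x)) - c * ∫ x, f x * (E * φ) x := by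
      rw [← integral_const_mul, ← integral_sub i1 (i2.const_mul _)]
      exact integral_congr_ae (Eventually.of_forall fun x => by ring)
    rw [e2] at e
    simp only [mul_assoc]
    linear_combination e
  let u : H1 := ⟨f, _, h⟩
  have hu : (contRep u : ℝ → ℂ) = fun x => k * Complex.exp (c * x : ℝ) := by
    refine contRep_eq_of_ae_eq (by fun_prop) ?_
    filter_upwards [hk] with x hx
    rw [← hx, mul_assoc, ← Complex.exp_add]
    simp [u]
  have hk0 : k = 0 := by
    by_contra hne
    have hkp : 0 < ‖k‖ := norm_pos_iff.2 hne
    -- At this point the exponent is `‖contRep u‖ / ‖k‖`, and `exp t ≥ t + 1` makes the value of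
    -- `contRep u` there at least `‖contRep u‖ + ‖k‖` in norm, exceeding its sup norm.
    have h1 := (contRep u).norm_coe_le_norm ((‖contRep u‖ / ‖k‖) / c)
    rw [hu, norm_mul, Complex.norm_exp, mul_div_cancel₀ _ hc, Complex.ofReal_re] at h1
    have h2 := Real.add_one_le_exp (‖contRep u‖ / ‖k‖)
    have h3 := mul_le_mul_of_nonneg_left h2 hkp.le
    rw [mul_add, mul_div_cancel₀ _ hkp.ne'] at h3
    linarith
  refine Lp.ext ?_
  filter_upwards [contRep_spec u, Lp.coeFn_zero ℂ 2 volume] with x hx h0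
  rw [h0, show f x = _ from hx, hu, hk0]
  simp

theorem toLp_fst_snd (p : WithLp 2 (L2 × L2)) : p = WithLp.toLp 2 (p.fst, p.snd) := rfl

/-- The graph of the weak derivative. -/
def weakDerivGraph : Submodule ℂ (WithLp 2 (L2 × L2)) where
  carrier := {p | IsWeakDeriv p.fst p.snd}
  add_mem' h h' := IsWeakDeriv.add h h'
  zero_mem' := by
    intro φ _
    simp only [WithLp.zero_fst, WithLp.zero_snd, L2.integral_zero_mul, neg_zero]
  smul_mem' c _ h := IsWeakDeriv.smul c h

/-- For a fixed test function the defining identity equates two continuous functionals of the pair,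
so the graph is an intersection of closed sets. -/
theorem isClosed_weakDerivGraph : IsClosed (weakDerivGraph : Set (WithLp 2 (L2 × L2))) := by
  have : (weakDerivGraph : Set (WithLp 2 (L2 × L2))) =
      ⋂ (φ : ℝ → ℂ) (hφ : IsTestFunction φ), {p | inner ℂ hφ.deriv.conj.toL2 p.fst
        = -inner ℂ hφ.conj.toL2 p.snd} := by
    ext p
    rw [mem_iInter]
    refine forall_congr' fun φ => ?_
    rw [mem_iInter]
    refine forall_congr' fun hφ => ?_
    rw [mem_ofPred_eq, ← integral_mul_eq_inner hφ.deriv, ← integral_mul_eq_inner hφ]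
  rw [this]
  refine isClosed_iInter fun φ => isClosed_iInter fun hφ => isClosed_eq ?_ ?_
  · fun_prop
  · fun_prop

/-- The graph of the derivative on test functions. -/
def testGraph : Submodule ℂ (WithLp 2 (L2 × L2)) where
  carrier := {p | ∃ φ : ℝ → ℂ, IsTestFunction φ ∧ p.fst =ᵐ[volume] φ ∧ p.snd =ᵐ[volume] deriv φ}
  add_mem' := by
    rintro p r ⟨φ, hφ, h1, h2⟩ ⟨ψ, hψ, h3, h4⟩
    refine ⟨φ + ψ, hφ.add hψ, (Lp.coeFn_add _ _).trans (h1.add h3),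
      (Lp.coeFn_add _ _).trans ((h2.add h4).trans (Eventually.of_forall fun x => ?_))⟩
    exact (deriv_add (hφ.differentiable x) (hψ.differentiable x)).symm
  zero_mem' := by
    refine ⟨0, isTestFunction_zero, Lp.coeFn_zero _ _ _,
      (Lp.coeFn_zero _ _ _).trans (Eventually.of_forall fun x => ?_)⟩
    simp
  smul_mem' := by
    rintro c p ⟨φ, hφ, h1, h2⟩
    refine ⟨c • φ, hφ.const_smul c, (Lp.coeFn_smul _ _).trans (h1.const_smul c),
      (Lp.coeFn_smul _ _).trans ((h2.const_smul c).trans (Eventually.of_forall fun x => ?_))⟩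
    exact (deriv_const_smul c (hφ.differentiable x)).symm

theorem mem_testGraph_iff {p : WithLp 2 (L2 × L2)} : p ∈ testGraph ↔
    ∃ φ : ℝ → ℂ, IsTestFunction φ ∧ p.fst =ᵐ[volume] φ ∧ p.snd =ᵐ[volume] deriv φ := Iff.rfl

theorem IsTestFunction.eq_toL2 {φ : ℝ → ℂ} (hφ : IsTestFunction φ) {f : L2}
    (h : f =ᵐ[volume] φ) : f = hφ.toL2 := Lp.ext (h.trans hφ.coeFn_toL2.symm)

theorem testGraph_le_weakDerivGraph : testGraph ≤ weakDerivGraph := by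
  rintro p ⟨φ, hφ, h1, h2⟩
  exact hφ.isWeakDeriv.congr h1 h2

/-- An `f ∈ H¹` that is `H¹`-orthogonal to all test functions satisfies `f'' = f` weakly. Then `f +
f'` is an `L²` solution of `g' = g` and vanishes; this leaves `f' = -f`, so `f` vanishes too. -/
theorem testGraph_orthogonal_inf_weakDerivGraph : (Submodule.orthogonal testGraph) ⊓ weakDerivGraph = ⊥ := by
  rw [Submodule.eq_bot_iff]
  rintro p ⟨hp, hw⟩
  replace hw : IsWeakDeriv p.fst p.snd := hw
  have hw' : IsWeakDeriv p.snd p.fst := fun φ hφ => by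
    have h0 := (Submodule.mem_orthogonal _ _).1 hp
      (WithLp.toLp 2 (hφ.conj.toL2, hφ.conj.deriv.toL2)) (mem_testGraph_iff.2
        ⟨_, hφ.conj, hφ.conj.coeFn_toL2, hφ.conj.deriv.coeFn_toL2⟩)
    rw [WithLp.prod_inner_apply] at h0
    change inner ℂ hφ.conj.toL2 p.fst + inner ℂ hφ.conj.deriv.toL2 p.snd = 0 at h0
    rw [hφ.conj.inner_toL2_left, hφ.conj.deriv.inner_toL2_left, hφ.deriv_conj] at h0
    simp only [Complex.conj_conj] at h0
    exact eq_neg_of_add_eq_zero_right h0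
  have hadd : p.fst + p.snd = 0 := by
    refine eq_zero_of_isWeakDeriv_smul one_ne_zero ?_
    rw [Complex.ofReal_one, one_smul, add_comm p.fst]
    have := hw.add hw'
    rwa [add_comm p.fst] at this
  have h1 : p.fst = 0 := by
    refine eq_zero_of_isWeakDeriv_smul (c := -1) (by norm_num) ?_
    rw [Complex.ofReal_neg, Complex.ofReal_one, neg_smul, one_smul, ← eq_neg_of_add_eq_zero_right hadd]
    exact hw
  have h2 : p.snd = 0 := by rw [eq_neg_of_add_eq_zero_right hadd, h1, neg_zero]
  rw [toLp_fst_snd p, h1, h2]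
  rfl

/-- The closure of `testGraph` is a closed subspace of `weakDerivGraph` whose orthogonal complement
inside it is zero. -/
theorem weakDerivGraph_le_closure : weakDerivGraph ≤ testGraph.topologicalClosure := by
  have h := Submodule.sup_orthogonal_inf_of_hasOrthogonalProjection
    (Submodule.topologicalClosure_minimal _ testGraph_le_weakDerivGraph isClosed_weakDerivGraph)
  rw [Submodule.orthogonal_closure, testGraph_orthogonal_inf_weakDerivGraph, sup_bot_eq] at h
  exact h.ge

/-- Test functions are dense in `H¹`. -/
theorem exists_test_tendsto (u : H1) : ∃ (φ : ℕ → ℝ → ℂ) (hφ : ∀ n, IsTestFunction (φ n)),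
    Tendsto (fun n => (hφ n).toL2) atTop (𝓝 (u : L2)) ∧
      Tendsto (fun n => (hφ n).deriv.toL2) atTop (𝓝 (weakDeriv u)) := by
  have hu : WithLp.toLp 2 ((u : L2), weakDeriv u) ∈ closure (testGraph : Set (WithLp 2 (L2 × L2))) :=
    weakDerivGraph_le_closure (weakDeriv_spec u)
  obtain ⟨p, hp, hlim⟩ := mem_closure_iff_seq_limit.1 hu
  choose φ hφ h1 h2 using hp
  refine ⟨φ, hφ, ?_, ?_⟩
  · simp only [← fun n => (hφ n).eq_toL2 (h1 n)]
    exact ((by fun_prop : Continuous fun p : WithLp 2 (L2 × L2) => p.fst).tendsto _).comp hlim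
  · simp only [← fun n => (hφ n).deriv.eq_toL2 (h2 n)]
    exact ((by fun_prop : Continuous fun p : WithLp 2 (L2 × L2) => p.snd).tendsto _).comp hlim

/-- The weak derivative is closed. -/
theorem isWeakDeriv_of_tendsto {u : ℕ → H1} {v w : L2}
    (hu : Tendsto (fun n => (u n : L2)) atTop (𝓝 v))
    (hw : Tendsto (fun n => weakDeriv (u n)) atTop (𝓝 w)) : IsWeakDeriv v w :=
  isClosed_weakDerivGraph.mem_of_tendsto
    (((WithLp.prod_continuous_toLp 2 L2 L2).tendsto (v, w)).comp (hu.prodMk_nhds hw))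
    (Eventually.of_forall fun n => weakDeriv_spec (u n))

/-! ### Estimates for the form: symmetry, semiboundedness, closedness, continuity. -/

/-- The total mass of a signed measure. -/
def totalMass (V : SignedMeasure ℝ) : ℝ :=
  V.toJordanDecomposition.posPart.real univ + V.toJordanDecomposition.negPart.real univ

theorem totalMass_nonneg (V : SignedMeasure ℝ) : 0 ≤ totalMass V := by
  unfold totalMass; positivity

theorem norm_integral_signed_le (V : SignedMeasure ℝ) (f : BoundedContinuousFunction ℝ ℂ) {C : ℝ}
    (hC : ∀ x, ‖f x‖ ≤ C) : ‖∫ᵛ x, f x ∂<•V‖ ≤ C * totalMass V := by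
  rw [integral_signed_eq, totalMass, mul_add]
  exact (norm_sub_le _ _).trans (add_le_add
    (norm_integral_le_of_norm_le_const (Eventually.of_forall hC))
    (norm_integral_le_of_norm_le_const (Eventually.of_forall hC)))

/-- This is where the reality of `V` enters: both Jordan parts are positive measures, and
conjugation commutes with each integral. -/
theorem conj_integral_signed (V : SignedMeasure ℝ) (f : BoundedContinuousFunction ℝ ℂ) :
    conj (∫ᵛ x, f x ∂<•V) = ∫ᵛ x, conj (f x) ∂<•V := by
  have h := integral_signed_eq V (star f)
  simp only [BoundedContinuousFunction.star_apply, RCLike.star_def] at h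
  rw [h, integral_signed_eq, map_sub, integral_conj, integral_conj]

theorem schrodingerForm_apply (h : ℝ) (V : SignedMeasure ℝ) (u v : H1) :
    schrodingerForm h V u v = (h : ℂ) ^ 2 * inner ℂ (weakDeriv u) (weakDeriv v)
      + ∫ᵛ x, conj (contRep u x) * contRep v x ∂<•V := rfl

theorem norm_integral_conj_mul_le (V : SignedMeasure ℝ) (u v : H1) {B C : ℝ}
    (hu : ∀ x, ‖contRep u x‖ ≤ B) (hv : ∀ x, ‖contRep v x‖ ≤ C) :
    ‖∫ᵛ x, conj (contRep u x) * contRep v x ∂<•V‖ ≤ B * C * totalMass V := by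
  refine norm_integral_signed_le V (star (contRep u) * contRep v) fun x => ?_
  rw [BoundedContinuousFunction.mul_apply, BoundedContinuousFunction.star_apply, norm_mul,
    norm_star]
  exact mul_le_mul (hu x) (hv x) (norm_nonneg _) ((norm_nonneg _).trans (hu x))

theorem isSymm_schrodingerForm (h : ℝ) (V : SignedMeasure ℝ) : (schrodingerForm h V).IsSymm where
  eq u v := by
    have e := conj_integral_signed V (star (contRep u) * contRep v)
    simp only [BoundedContinuousFunction.mul_apply, BoundedContinuousFunction.star_apply,
      RCLike.star_def, map_mul, Complex.conj_conj] at e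
    simp only [schrodingerForm_apply, map_add, map_mul, map_pow, Complex.conj_ofReal,
      inner_conj_symm, e, mul_comm (contRep u _)]

/-- The Gårding inequality for the form. -/
theorem exists_garding (V : SignedMeasure ℝ) {h : ℝ} (hh : 0 < h) :
    ∃ L : ℝ, ∀ u : H1, h ^ 2 / 2 * ‖weakDeriv u‖ ^ 2 - L * ‖(u : L2)‖ ^ 2
      ≤ (schrodingerForm h V u u).re := by
  have hM := totalMass_nonneg V
  set M := totalMass V
  -- Chosen so that `2 s² M ≤ h² / 2`; the `+ 1` covers `M = 0`.
  set s : ℝ := h / (2 * (M + 1)) with hs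
  have hs0 : 0 < s := by positivity
  refine ⟨2 * s⁻¹ ^ 2 * M, fun u => ?_⟩
  have h1 := norm_integral_conj_mul_le V u u (norm_contRep_apply_le u hs0)
    (norm_contRep_apply_le u hs0)
  have h2 := (abs_le.1 ((Complex.abs_re_le_norm _).trans h1)).1
  rw [schrodingerForm_apply, Complex.add_re, ← Complex.ofReal_pow, Complex.re_ofReal_mul,
    inner_self_re]
  set a := ‖(u : L2)‖
  set b := ‖weakDeriv u‖
  have h3 : (s⁻¹ * a + s * b) * (s⁻¹ * a + s * b) ≤ 2 * s⁻¹ ^ 2 * a ^ 2 + 2 * s ^ 2 * b ^ 2 := by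
    nlinarith [sq_nonneg (s⁻¹ * a - s * b)]
  have h4 := mul_le_mul_of_nonneg_right h3 hM
  have h5 : 2 * s ^ 2 * M ≤ h ^ 2 / 2 := by
    have e : 2 * s ^ 2 * M = h ^ 2 / 2 * (M / (M + 1) ^ 2) := by
      rw [hs]; field_simp
    rw [e]
    refine mul_le_of_le_one_right (by positivity) ?_
    rw [div_le_one (by positivity)]
    nlinarith
  have h6 := mul_le_mul_of_nonneg_right h5 (sq_nonneg b)
  linarith

theorem formSemibounded_schrodingerForm (V : SignedMeasure ℝ) {h : ℝ} (hh : 0 < h) :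
    FormSemibounded (schrodingerForm h V) := by
  obtain ⟨L, hL⟩ := exists_garding V hh
  refine ⟨-L, fun u => ?_⟩
  have h1 := hL u
  rw [Submodule.coe_norm]
  have : 0 ≤ h ^ 2 / 2 * ‖weakDeriv u‖ ^ 2 := by positivity
  linarith

theorem norm_schrodingerForm_le (h : ℝ) (V : SignedMeasure ℝ) (u v : H1) :
    ‖schrodingerForm h V u v‖ ≤ h ^ 2 * (‖weakDeriv u‖ * ‖weakDeriv v‖)
      + (‖(u : L2)‖ + ‖weakDeriv u‖) * (‖(v : L2)‖ + ‖weakDeriv v‖) * totalMass V := by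
  have hb : ∀ w : H1, ∀ x, ‖contRep w x‖ ≤ ‖(w : L2)‖ + ‖weakDeriv w‖ := fun w x => by
    simpa using norm_contRep_apply_le w one_pos x
  rw [schrodingerForm_apply]
  refine (norm_add_le _ _).trans (add_le_add ?_ (norm_integral_conj_mul_le V u v (hb u) (hb v)))
  rw [norm_mul, norm_pow, Complex.norm_real, Real.norm_eq_abs, sq_abs]
  gcongr
  exact norm_inner_le_norm _ _

/-- The Gårding inequality applied to differences makes the derivatives Cauchy in `L²`. Their limit
is the weak derivative of the `L²` limit, and `q` is bounded by the `H¹` norms. -/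
theorem formClosed_schrodingerForm (V : SignedMeasure ℝ) {h : ℝ} (hh : 0 < h) :
    FormClosed (schrodingerForm h V) := by
  intro u v hu hq
  obtain ⟨L, hL⟩ := exists_garding V hh
  have hd : Tendsto (fun p : ℕ × ℕ => ‖((u p.1 - u p.2 : H1) : L2)‖ ^ 2) atTop (𝓝 0) := by
    have h1 := (cauchySeq_iff_tendsto_dist_atTop_0.1 hu.cauchySeq).pow 2
    simpa [dist_eq_norm] using h1
  have hre := (Complex.continuous_re.tendsto 0).comp hq
  have hw : CauchySeq fun n => weakDeriv (u n) := by
    rw [cauchySeq_iff_tendsto_dist_atTop_0]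
    have h1 : Tendsto (fun p : ℕ × ℕ => ‖weakDeriv (u p.1 - u p.2)‖ ^ 2) atTop (𝓝 0) := by
      have h2 := (hre.add (hd.const_mul L)).const_mul (2 / h ^ 2)
      simp only [mul_zero, add_zero, Complex.zero_re] at h2
      refine squeeze_zero (fun p => sq_nonneg _) (fun p => ?_) h2
      have h3 := hL (u p.1 - u p.2)
      rw [div_mul_eq_mul_div, le_div_iff₀ (by positivity)]
      simp only [Function.comp_apply]
      linarith
    have h4 := h1.sqrt
    simpa [dist_eq_norm] using h4
  obtain ⟨w, hw⟩ := cauchySeq_tendsto_of_complete hw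
  have hvw : IsWeakDeriv v w := isWeakDeriv_of_tendsto hu hw
  refine ⟨⟨w, hvw⟩, ?_⟩
  have e : weakDeriv ⟨v, ⟨w, hvw⟩⟩ = w := weakDeriv_eq_of_isWeakDeriv hvw
  have h1 : Tendsto (fun n => ‖((u n - ⟨v, ⟨w, hvw⟩⟩ : H1) : L2)‖) atTop (𝓝 0) :=
    tendsto_iff_norm_sub_tendsto_zero.1 hu
  have h2 : Tendsto (fun n => ‖weakDeriv (u n - ⟨v, ⟨w, hvw⟩⟩)‖) atTop (𝓝 0) := by
    simp only [map_sub, e]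
    exact tendsto_iff_norm_sub_tendsto_zero.1 hw
  refine squeeze_zero_norm (fun n => norm_schrodingerForm_le h V _ _) ?_
  have h3 := ((h2.mul h2).const_mul (h ^ 2)).add
    (((h1.add h2).mul (h1.add h2)).mul_const (totalMass V))
  simpa using h3

/-- The form is continuous in its second argument along `H¹`-convergent sequences. -/
theorem tendsto_schrodingerForm (h : ℝ) (V : SignedMeasure ℝ) (u : H1) {v : ℕ → H1} {v₀ : H1}
    (hv : Tendsto (fun n => (v n : L2)) atTop (𝓝 (v₀ : L2)))
    (hv' : Tendsto (fun n => weakDeriv (v n)) atTop (𝓝 (weakDeriv v₀))) :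
    Tendsto (fun n => schrodingerForm h V u (v n)) atTop (𝓝 (schrodingerForm h V u v₀)) := by
  have h1 : Tendsto (fun n => ‖((v n - v₀ : H1) : L2)‖) atTop (𝓝 0) :=
    tendsto_iff_norm_sub_tendsto_zero.1 hv
  have h2 : Tendsto (fun n => ‖weakDeriv (v n - v₀)‖) atTop (𝓝 0) := by
    simp only [map_sub]
    exact tendsto_iff_norm_sub_tendsto_zero.1 hv'
  rw [tendsto_iff_norm_sub_tendsto_zero]
  simp only [← map_sub]
  refine squeeze_zero (fun n => norm_nonneg _) (fun n => norm_schrodingerForm_le h V u _) ?_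
  have h3 := ((h2.const_mul ‖weakDeriv u‖).const_mul (h ^ 2)).add
    (((h1.add h2).const_mul (‖(u : L2)‖ + ‖weakDeriv u‖)).mul_const (totalMass V))
  simpa using h3

/-! ### The distribution `P u` in terms of the form. -/

theorem schrodingerDistribution_eq (h : ℝ) (V : SignedMeasure ℝ) (u : H1) {φ : ℝ → ℂ}
    (hφ : IsTestFunction φ) : schrodingerDistribution h V u φ =
      (h : ℂ) ^ 2 * (∫ x, weakDeriv u x * deriv φ x) + ∫ᵛ x, contRep u x * φ x ∂<•V := by
  rw [schrodingerDistribution, weakDeriv_spec u _ hφ.deriv]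
  ring

/-- The conjugations arise because the form is antilinear in `u` while the distribution is linear in
`u`. -/
theorem schrodingerForm_toH1 (h : ℝ) (V : SignedMeasure ℝ) (u : H1) {φ : ℝ → ℂ}
    (hφ : IsTestFunction φ) : schrodingerForm h V u hφ.toH1 =
      conj (schrodingerDistribution h V u fun x => conj (φ x)) := by
  obtain ⟨b, hb⟩ := hφ.exists_bounded
  have e := conj_integral_signed V (contRep u * star b)
  simp only [BoundedContinuousFunction.mul_apply, BoundedContinuousFunction.star_apply,
    RCLike.star_def, map_mul, Complex.conj_conj, hb] at e
  rw [schrodingerDistribution_eq h V u hφ.conj, schrodingerForm_apply, hφ.weakDeriv_toH1,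
    hφ.contRep_toH1, ← inner_conj_symm, hφ.deriv.inner_toL2_left, hφ.deriv_conj, map_add, e,
    map_mul, map_pow, Complex.conj_ofReal]

theorem IsTestFunction.inner_toL2_right {φ : ℝ → ℂ} (hφ : IsTestFunction φ) (f : L2) :
    inner ℂ f hφ.toL2 = conj (∫ x, f x * conj (φ x)) := by
  rw [← inner_conj_symm, hφ.inner_toL2_left]

/-- On test functions both sides say the same thing. Both `q(u, ·)` and `⟪f, ·⟫` are continuous
along `H¹`-convergent sequences, so density of test functions gives all of `H¹`. -/
theorem isSchrodingerImage_iff {h : ℝ} {V : SignedMeasure ℝ} {u : H1} {f : L2} :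
    IsSchrodingerImage h V u f ↔ ∀ v : H1, schrodingerForm h V u v = inner ℂ f (v : L2) := by
  constructor
  · intro hf v
    obtain ⟨φ, hφ, h1, h2⟩ := exists_test_tendsto v
    have h3 : Tendsto (fun n => schrodingerForm h V u (hφ n).toH1) atTop
        (𝓝 (schrodingerForm h V u v)) := by
      refine tendsto_schrodingerForm h V u h1 ?_
      simpa only [IsTestFunction.weakDeriv_toH1] using h2
    have h4 : Tendsto (fun n => inner ℂ f (hφ n).toL2) atTop (𝓝 (inner ℂ f (v : L2))) :=
      tendsto_const_nhds.inner h1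
    refine tendsto_nhds_unique h3 (h4.congr fun n => ?_)
    rw [schrodingerForm_toH1, hf _ (hφ n).conj, (hφ n).inner_toL2_right]
  · intro hq φ hφ
    have e := hq hφ.conj.toH1
    rw [schrodingerForm_toH1] at e
    have e' := (starRingEnd ℂ).injective (e.trans (hφ.conj.inner_toL2_right f))
    simpa only [Complex.conj_conj] using e'

/-! ### Boundedness of `u'` when `P u ∈ L²`. -/

section Regularity

/-- The distribution function `x ↦ ∫_{(-∞, x)} g dμ`. -/
def cumulative (μ : Measure ℝ) (g : ℝ → ℂ) (x : ℝ) : ℂ := ∫ t in Iio x, g t ∂μ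

variable {μ : Measure ℝ} (g : BoundedContinuousFunction ℝ ℂ)

/-- Writing the moving domain as a kernel on `ℝ × ℝ` gives measurability in `x` and prepares for
Fubini. -/
theorem cumulative_eq_integral_indicator (x : ℝ) : cumulative μ g x =
    ∫ t, {p : ℝ × ℝ | p.1 < p.2}.indicator (fun p => g p.1) (t, x) ∂μ := by
  rw [cumulative, ← integral_indicator measurableSet_Iio]
  rfl

theorem stronglyMeasurable_indicator : StronglyMeasurable
    ({p : ℝ × ℝ | p.1 < p.2}.indicator fun p => g p.1) :=
  (g.continuous.comp continuous_fst).stronglyMeasurable.indicator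
    (isOpen_lt continuous_fst continuous_snd).measurableSet

variable [IsFiniteMeasure μ]

theorem stronglyMeasurable_cumulative : StronglyMeasurable (cumulative μ g) := by
  rw [funext (cumulative_eq_integral_indicator (μ := μ) g)]
  exact (stronglyMeasurable_indicator g).integral_prod_left'

theorem norm_cumulative_le (x : ℝ) : ‖cumulative μ g x‖ ≤ ‖g‖ * μ.real univ := by
  refine (norm_setIntegral_le_of_norm_le_const (measure_lt_top _ _)
    fun t _ => g.norm_coe_le_norm t).trans ?_
  exact mul_le_mul_of_nonneg_left (measureReal_mono (subset_univ _)) (norm_nonneg _)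

/-- The distributional derivative of the distribution function of `g μ` is `g μ`: exchange the
integrals and use `∫_t^∞ φ' = -φ(t)`. -/
theorem integral_cumulative_mul_deriv {φ : ℝ → ℂ} (hφ : IsTestFunction φ) :
    ∫ x, cumulative μ g x * deriv φ x = -∫ t, g t * φ t ∂μ := by
  let k : ℝ × ℝ → ℂ := {p : ℝ × ℝ | p.1 < p.2}.indicator fun p => g p.1
  have hφi : Integrable (deriv φ) :=
    hφ.deriv.continuous.integrable_of_hasCompactSupport hφ.deriv.2
  have hi : Integrable (fun p : ℝ × ℝ => k p * deriv φ p.2) (μ.prod volume) := by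
    refine (hφi.comp_snd μ).bdd_mul (c := ‖g‖) (stronglyMeasurable_indicator g).aestronglyMeasurable
      (Eventually.of_forall fun p => ?_)
    exact (norm_indicator_le_norm_self _ _).trans (g.norm_coe_le_norm _)
  calc ∫ x, cumulative μ g x * deriv φ x
      = ∫ x, ∫ t, k (t, x) * deriv φ x ∂μ := by
        refine integral_congr_ae (Eventually.of_forall fun x => ?_)
        simp only [cumulative_eq_integral_indicator, integral_mul_const, k]
    _ = ∫ t, ∫ x, k (t, x) * deriv φ x ∂volume ∂μ := (integral_integral_swap hi).symm
    _ = ∫ t, -(g t * φ t) ∂μ := by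
        refine integral_congr_ae (Eventually.of_forall fun t => ?_)
        have e : (fun x => k (t, x) * deriv φ x) = (Ioi t).indicator fun x => g t * deriv φ x := by
          funext x
          by_cases hx : t < x <;> simp [k, indicator, hx]
        simp only [e]
        rw [integral_indicator measurableSet_Ioi, integral_const_mul,
          hφ.2.integral_Ioi_deriv_eq (hφ.1.of_le (by exact_mod_cast le_top))]
        ring
    _ = -∫ t, g t * φ t ∂μ := integral_neg _

/-- If `u ∈ H¹` and `P u ∈ L²` then `u'` is bounded. -/
theorem IsSchrodingerImage.memLp_top_weakDeriv {h : ℝ} (hh : 0 < h) {V : SignedMeasure ℝ} {u : H1}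
    {f : L2} (hf : IsSchrodingerImage h V u f) : MemLp (weakDeriv u) ∞ volume := by
  set μ := V.toJordanDecomposition.posPart
  set ν := V.toJordanDecomposition.negPart
  -- The distribution function of `u_c V`, so that `G' = u_c V` as distributions.
  let G : ℝ → ℂ := fun x => cumulative μ (contRep u) x - cumulative ν (contRep u) x
  have hGm : StronglyMeasurable G :=
    (stronglyMeasurable_cumulative _).sub (stronglyMeasurable_cumulative _)
  set M := ‖contRep u‖ * μ.real univ + ‖contRep u‖ * ν.real univ with hM
  have hGb : ∀ x, ‖G x‖ ≤ M := fun x =>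
    (norm_sub_le _ _).trans (add_le_add (norm_cumulative_le _ x) (norm_cumulative_le _ x))
  have hGtop : MemLp G ∞ volume :=
    memLp_top_of_bound hGm.aestronglyMeasurable M (Eventually.of_forall hGb)
  have hGl : LocallyIntegrable G volume := hGtop.locallyIntegrable le_top
  have hul := (weakDeriv u).locallyIntegrable
  -- Subtracting `G` removes the measure from the equation: `W' = h² u'' - u_c V = -f`.
  let W : ℝ → ℂ := fun x => (h : ℂ) ^ 2 * weakDeriv u x - G x
  have hWl : LocallyIntegrable W volume := (hul.smul ((h : ℂ) ^ 2)).sub hGl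
  have hW : IsWeakDeriv W (-f : L2) := fun φ hφ => by
    have e1 := hf φ hφ
    obtain ⟨b, hb⟩ := hφ.exists_bounded
    have e2 := integral_signed_eq V (contRep u * b)
    simp only [BoundedContinuousFunction.mul_apply, hb] at e2
    rw [schrodingerDistribution_eq h V u hφ, e2] at e1
    have i1 := (weakDeriv u).integrable_mul hφ.deriv
    have i2 : ∀ (ρ : Measure ℝ) [IsFiniteMeasure ρ],
        Integrable fun x => cumulative ρ (contRep u) x * deriv φ x := fun ρ _ =>
      (hφ.deriv.continuous.integrable_of_hasCompactSupport hφ.deriv.2).bdd_mul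
        (stronglyMeasurable_cumulative _).aestronglyMeasurable
        (Eventually.of_forall (norm_cumulative_le _))
    have e3 : ∫ x, W x * deriv φ x = (h : ℂ) ^ 2 * (∫ x, weakDeriv u x * deriv φ x)
        - ((∫ x, cumulative μ (contRep u) x * deriv φ x)
          - ∫ x, cumulative ν (contRep u) x * deriv φ x) := by
      rw [← integral_const_mul, ← integral_sub (i2 μ) (i2 ν),
        ← integral_sub (i1.const_mul _) (by exact (i2 μ).sub (i2 ν))]
      exact integral_congr_ae (Eventually.of_forall fun x => by simp only [W, G]; ring)
    have e4 : ∫ x, (-f : L2) x * φ x = -∫ x, f x * φ x := by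
      rw [← integral_neg]
      refine integral_congr_ae ?_
      filter_upwards [Lp.coeFn_neg f] with x hx
      rw [hx, Pi.neg_apply, neg_mul]
    rw [e3, e4, integral_cumulative_mul_deriv _ hφ, integral_cumulative_mul_deriv _ hφ, neg_neg,
      ← e1]
    ring
  obtain ⟨c, hc⟩ := hW.exists_ae_eq_primitive hWl (-f : L2).locallyIntegrable
  have hI := intervalIntegrable_of_locallyIntegrable (-f : L2).locallyIntegrable
  set g : ℝ → ℂ := fun x => (∫ t in (0 : ℝ)..x, (-f : L2) t) + c with hg
  have hgc : Continuous g := (continuous_primitive (-f : L2).locallyIntegrable).add continuous_const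
  -- `G` need not lie in `L²`, so `W` need not either. The pointwise estimate is applied with `s =
  -- 1`: unit averages are controlled by `‖u'‖` and `M`, and the Hölder constant is `‖f‖`.
  have hgb : ∀ x, ‖g x‖ ≤ (1 : ℝ)⁻¹ * (h ^ 2 * ‖weakDeriv u‖ + M) + 1 * ‖(-f : L2)‖ := fun x => by
    refine norm_le_of_norm_intervalIntegral_le hgc one_pos (fun x y hxy => ?_) x ?_
    · have e : g y - g x = ∫ t in x..y, (-f : L2) t := by
        rw [← intervalIntegral.integral_interval_sub_left (hI 0 y) (hI 0 x)]
        simp only [hg]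
        ring
      rw [e]
      exact norm_intervalIntegral_le _ hxy
    · rw [one_pow, one_mul, ← intervalIntegral.integral_congr_ae (hc.mono fun t ht _ => ht),
        intervalIntegral.integral_sub
          ((intervalIntegrable_of_locallyIntegrable hul _ _).const_mul _)
          (intervalIntegrable_of_locallyIntegrable hGl _ _),
        intervalIntegral.integral_const_mul]
      refine (norm_sub_le _ _).trans (add_le_add ?_ ?_)
      · rw [norm_mul, norm_pow, Complex.norm_real, Real.norm_eq_abs, sq_abs]
        gcongr
        simpa using norm_intervalIntegral_le (weakDeriv u) (x := x) (y := x + 1) (by linarith)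
      · have := intervalIntegral.norm_integral_le_of_norm_le_const (a := x) (b := x + 1)
          (f := G) (C := M) fun t _ => hGb t
        simpa using this
  have hgtop : MemLp g ∞ volume :=
    memLp_top_of_bound hgc.aestronglyMeasurable _ (Eventually.of_forall hgb)
  refine MemLp.ae_eq ?_ ((hgtop.add hGtop).const_mul (((h : ℂ) ^ 2)⁻¹))
  filter_upwards [hc] with x hx
  have hh' : (h : ℂ) ≠ 0 := by exact_mod_cast hh.ne'
  rw [Pi.add_apply, ← hx]
  simp only [W]
  field_simp
  ring

end Regularity

/-! ### Identification of the operator and conclusion. -/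

theorem isOperatorOfForm_schrodingerOperator (V : SignedMeasure ℝ) {h : ℝ} (hh : 0 < h) :
    IsOperatorOfForm (schrodingerForm h V) (schrodingerOperator h V) := by
  intro u f
  rw [LinearPMap.mem_graph_iff]
  constructor
  · rintro ⟨y, hy, hf⟩
    obtain ⟨w, hw, himg⟩ := schrodingerOperator_spec h V y
    obtain rfl : (w : L2) = u := hw.trans hy
    refine ⟨w.2, isSchrodingerImage_iff.1 ?_⟩
    rwa [← show schrodingerOperator h V y = f from hf]
  · rintro ⟨hu, hq⟩
    have himg := isSchrodingerImage_iff.2 hq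
    let y : schrodingerDomain h V := ⟨u, ⟨u, hu⟩, rfl, himg.memLp_top_weakDeriv hh, f, himg⟩
    exact ⟨y, rfl, image_unique (schrodingerOperator_spec h V y) ⟨⟨u, hu⟩, rfl, himg⟩⟩

end

end MeasureSchrodinger

theorem lemma3p1 (V : MeasureTheory.SignedMeasure ℝ) (h : ℝ) (hh : 0 < h) :
    Dense (MeasureSchrodinger.schrodingerDomain h V : Set MeasureSchrodinger.L2) ∧
    IsSelfAdjoint (MeasureSchrodinger.schrodingerOperator h V) ∧
    (MeasureSchrodinger.schrodingerForm h V).IsSymm ∧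
    MeasureSchrodinger.FormSemibounded (MeasureSchrodinger.schrodingerForm h V) ∧
    MeasureSchrodinger.FormClosed (MeasureSchrodinger.schrodingerForm h V) ∧
    MeasureSchrodinger.IsOperatorOfForm (MeasureSchrodinger.schrodingerForm h V)
      (MeasureSchrodinger.schrodingerOperator h V) := by
  have hs := MeasureSchrodinger.isSymm_schrodingerForm h V
  have hb := MeasureSchrodinger.formSemibounded_schrodingerForm V hh
  have hc := MeasureSchrodinger.formClosed_schrodingerForm V hh
  have hA := MeasureSchrodinger.isOperatorOfForm_schrodingerOperator V hh
  exact ⟨hA.dense_domain hs hb hc, hA.isSelfAdjoint hs hb hc, hs, hb, hc, hA⟩
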